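/- Let $R$ be a commutative Noetherian ring and let $H$ be a Hopf $R$-algebra, projective as an $R$-module, with comultiplication $\Delta(h)=\sum h_1\otimes h_2$, counit $\varepsilon$, dual $H^*=\mathrm{Hom}_R(H,R)$ (an algebra under convolution $(f\star g)(h)=\sum f(h_1)g(h_2)$) and a twisted antipode $\overline S$, i.e. an $R$-linear map $\overline S:H\to H$ with $\sum\overline S(h_2)h_1=\varepsilon(h)1=\sum h_2\overline S(h_1)$. The algebra $H$ acts on $H^*$ by $(afb)(x)=f(bxa)$; let $H^\circ\subseteq H^*$ be the set of those $f$ for which $HfH$ is a finitely generated $R$-module. Assume that $H$ is a Hopf $\alpha$-algebra: $H^\circ$ is a pure submodule of the module $R^H$ of all functions $H\to R$ (so that $H^\circ$ is a bialgebra, with $\Delta(f)=\sum f_1\otimes f_2$ determined by $f(hk)=\sum f_1(h)f_2(k)$). Let $U\subseteq H^\circ$ be an $R$-subbialgebra: a pure submodule of $H^\circ$ with $\varepsilon\in U$, $U\star U\subseteq U$ and $\Delta(U)\subseteq U\otimes_R U$. Let $A$ be a left $H$-module algebra which is $U$-locally finite: for every $a\in A$ there are $f_1,\dots,f_k\in U$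 such that $ha=0$ whenever $f_1(h)=\dots=f_k(h)=0$. Let $\varrho:A\to A\otimes_R U$, $\varrho(a)=\sum a_0\otimes a_1$, be the induced right $U$-comodule structure, characterized by $ha=\sum a_1(h)\,a_0$ for all $h\in H$. Let $C\subseteq U$ be an $R$-submodule of coefficients of $A$, i.e. every $\varrho(a)$ can be written as a sum $\sum a_0\otimes a_1$ with all $a_1\in C$. Assume there is an $R$-submodule $V\subseteq H^*$, stable under the right action $(fh)(k)=f(hk)$, such that $C\subseteq V$, $f\circ\overline S\in V$ for all $f\in C$, and $(V,U)$ satisfies the RL-condition: for every $g\in V$ there are finitely many $(h_j,g_j)\in H\times U$ with $\sum g(k_1)k_2=\sum_j h_j\bigl(\sum k_1g_j(k_2)\bigr)$ for all $k\in H$. Let $A\#H$ be $A\otimes_R H$ with multiplication $(a\#h)(b\#k)=\sum a(h_1b)\#h_2k$, a right $H$-comodule algebra through $\mathrm{id}\otimes\Delta$. For a right $H$-comodule algebra $B$, let $B\#U$ be $B\otimes_R U$ with multiplication $(b\#f)(b'\#f')=\sum bb'_0\#(fb'_1)\star f'$. Density of a set of linear maps in a larger one refers to the finite topology: every element of the larger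 set agrees on each given finite set of arguments with an element of the smaller one. 1. If $U$ is dense in $H^*$, then there are a dense $R$-subalgebra $\mathcal L\subseteq\mathrm{End}_R(H)$ and an isomorphism of $R$-algebras $(A\#H)\#U\simeq A\otimes_R\mathcal L$. 2. The same conclusion holds if $R$ is a QF ring (artinian and injective as a module over itself), $H$ is residually finite (the canonical map $H\to (H^\circ)^*$ is injective), and $U$ is dense in $H^\circ$. -/

import Mathlib

open scoped TensorProduct

noncomputable section

namespace HopfDuality

universe u v w

/-! ## Pure maps, pairings, the finite topology -/

section Modules

variable {R : Type u} [CommRing R]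

/-- An `R`-linear map `f : K → M` is pure if `f ⊗ id : K ⊗ N → M ⊗ N` is injective for every
`R`-module `N`. It is enough to let `N` run over the modules in the universe of `R`, since every
module is the directed union of its finitely generated submodules. -/
def IsPure {K : Type v} {M : Type w} [AddCommMonoid K] [Module R K] [AddCommMonoid M] [Module R M]
    (f : K →ₗ[R] M) : Prop :=
  ∀ (N : Type u) [AddCommGroup N] [Module R N], Function.Injective (f.rTensor N)

/-- The canonical map `M ⊗ U → Hom_R(W, M)`, `m ⊗ f ↦ [x ↦ f(x) m]`, for `U ⊆ W*`. -/
def alphaMap {W : Type v} [AddCommGroup W] [Module R W] (U : Submodule R (W →ₗ[R] R))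
    (M : Type w) [AddCommGroup M] [Module R M] : M ⊗[R] U →ₗ[R] (W →ₗ[R] M) :=
  dualTensorHom R W M ∘ₗ (TensorProduct.comm R M (W →ₗ[R] R)).toLinearMap ∘ₗ
    U.subtype.lTensor M

/-- `K` is dense in `S`, for `K` and `S` sets of linear maps `M → N`, in the finite topology (the
topology induced from the product topology on `N ^ M` with `N` discrete): every element of `S`
agrees on every finite subset of `M` with an element of `K`. -/
def IsFinitelyDense {M : Type v} {N : Type w} [AddCommGroup M] [Module R M] [AddCommGroup N]
    [Module R N] (K S : Set (M →ₗ[R] N)) : Prop :=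
  ∀ f ∈ S, ∀ F : Finset M, ∃ g ∈ K, ∀ x ∈ F, g x = f x

end Modules

/-- A commutative ring is quasi-Frobenius if it is artinian and injective as a module over
itself. -/
structure IsQuasiFrobenius (R : Type u) [CommRing R] : Prop where
  artinian : IsArtinianRing R
  selfInjective : Module.Injective R R

/-! ## The finite dual -/

section FiniteDual

variable (R : Type u) [CommRing R]

section Translates

variable {R} {A : Type v} [Ring A] [Algebra R A]

/-- The regular actions on the dual: `a f b` is the functional `x ↦ f (b x a)`. -/
def translate (a b : A) (f : A →ₗ[R] R) : A →ₗ[R] R :=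
  f ∘ₗ LinearMap.mulLeft R b ∘ₗ LinearMap.mulRight R a

@[simp] lemma translate_apply (a b : A) (f : A →ₗ[R] R) (x : A) :
    translate a b f x = f (b * (x * a)) := rfl

/-- The sub-bimodule `A f A` of the dual of `A` generated by `f`. -/
def bimoduleSpan (f : A →ₗ[R] R) : Submodule R (A →ₗ[R] R) :=
  Submodule.span R (Set.range fun p : A × A => translate p.1 p.2 f)

end Translates

variable (A : Type v) [Ring A] [Algebra R A] [IsNoetherianRing R]

/-- The finite dual `A°`: the functionals `f` such that `A f A` is a finitely generated
`R`-module. -/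
def finiteDual : Submodule R (A →ₗ[R] R) where
  carrier := {f | (bimoduleSpan f).FG}
  zero_mem' := by
    have : bimoduleSpan (0 : A →ₗ[R] R) = ⊥ := by
      rw [bimoduleSpan, Submodule.span_eq_bot]
      rintro _ ⟨p, rfl⟩
      ext x
      simp
    rw [Set.mem_ofPred_eq, this]
    exact Submodule.fg_bot
  add_mem' := by
    intro f g hf hg
    have hle : bimoduleSpan (f + g) ≤ bimoduleSpan f ⊔ bimoduleSpan g := by
      rw [bimoduleSpan, Submodule.span_le]
      rintro _ ⟨p, rfl⟩
      have : translate p.1 p.2 (f + g) = translate p.1 p.2 f + translate p.1 p.2 g := by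
        ext x; simp
      simp only [this]
      exact Submodule.add_mem_sup (Submodule.subset_span ⟨p, rfl⟩)
        (Submodule.subset_span ⟨p, rfl⟩)
    have hN := isNoetherian_of_fg_of_noetherian _ (Submodule.FG.sup hf hg)
    exact Submodule.FG.of_le_of_isNoetherian hle
  smul_mem' := by
    intro r f hf
    have hle : bimoduleSpan (r • f) ≤ bimoduleSpan f := by
      rw [bimoduleSpan, Submodule.span_le]
      rintro _ ⟨p, rfl⟩
      have : translate p.1 p.2 (r • f) = r • translate p.1 p.2 f := by
        ext x; simp
      simp only [this]
      exact Submodule.smul_mem _ _ (Submodule.subset_span ⟨p, rfl⟩)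
    have hN := isNoetherian_of_fg_of_noetherian _ hf
    exact Submodule.FG.of_le_of_isNoetherian hle

/-- `A` is an `α`-algebra: `A°` is pure in the module `R ^ A` of all functions `A → R`. -/
def IsAlphaAlgebra : Prop :=
  IsPure (LinearMap.ltoFun R A R R ∘ₗ (finiteDual R A).subtype)

/-- `A` is residually finite: the canonical map `A → (A°)*` is injective. -/
def IsResiduallyFinite : Prop :=
  Function.Injective ((finiteDual R A).subtype.dualMap ∘ₗ Module.Dual.eval R A)

end FiniteDual

/-! ## Module algebras, comodule algebras, smash products -/

section Bialgebra

variable {R : Type u} [CommRing R] {H : Type v} [Ring H] [Bialgebra R H]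

/-- Convolution of functionals, `(f ⋆ g)(h) = ∑ f(h₁) g(h₂)`. -/
def conv (f g : H →ₗ[R] R) : H →ₗ[R] R :=
  (WithConv.toConv f * WithConv.toConv g).ofConv

/-- The right regular action of `H` on its dual, `(f h)(k) = f(h k)`. -/
def rightAct (f : H →ₗ[R] R) (h : H) : H →ₗ[R] R := f ∘ₗ LinearMap.mulLeft R h

@[simp] lemma rightAct_apply (f : H →ₗ[R] R) (h k : H) : rightAct f h k = f (h * k) := rfl

/-- A submodule of the dual of `H` stable under the right regular `H`-action. -/
def IsRightHSubmodule (V : Submodule R (H →ₗ[R] R)) : Prop :=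
  ∀ f ∈ V, ∀ h : H, rightAct f h ∈ V

/-- A right `H`-module subalgebra (with unit `ε`) of the convolution algebra `H*`. -/
class IsRightModuleSubalgebra (U : Submodule R (H →ₗ[R] R)) : Prop where
  counit_mem : (Coalgebra.counit : H →ₗ[R] R) ∈ U
  conv_mem : ∀ f ∈ U, ∀ g ∈ U, conv f g ∈ U
  act_mem : IsRightHSubmodule U

/-- `U ⊆ H°` is an `R`-subbialgebra: a pure submodule of `H°` which is a subalgebra of the
convolution algebra and satisfies `Δ(U) ⊆ U ⊗ U`. The coproduct of `f ∈ H°` is the tensor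
`∑ fᵢ ⊗ gᵢ` with `f (h k) = ∑ fᵢ(h) gᵢ(k)`. -/
class IsSubbialgebra [IsNoetherianRing R] (U : Submodule R (H →ₗ[R] R)) : Prop where
  le_finiteDual : U ≤ finiteDual R H
  pure : IsPure (Submodule.inclusion le_finiteDual)
  counit_mem : (Coalgebra.counit : H →ₗ[R] R) ∈ U
  conv_mem : ∀ f ∈ U, ∀ g ∈ U, conv f g ∈ U
  comul_mem : ∀ f ∈ U, ∃ t : U ⊗[R] U, ∀ h k : H,
    f (h * k) = LinearMap.mul' R R
      (TensorProduct.map (LinearMap.applyₗ h ∘ₗ U.subtype) (LinearMap.applyₗ k ∘ₗ U.subtype) t)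

instance IsSubbialgebra.isRightModuleSubalgebra [IsNoetherianRing R]
    (U : Submodule R (H →ₗ[R] R)) [hU : IsSubbialgebra U] : IsRightModuleSubalgebra U where
  counit_mem := hU.counit_mem
  conv_mem := hU.conv_mem
  act_mem := by
    intro f hf h
    obtain ⟨t, ht⟩ := hU.comul_mem f hf
    have key : rightAct f h = (TensorProduct.lid R U
        ((LinearMap.applyₗ h ∘ₗ U.subtype).rTensor U t) : U) := by
      ext k
      rw [rightAct_apply, ht]
      clear ht
      induction t with
      | zero => simp
      | tmul x y => simp
      | add x y hx hy => simp [hx, hy]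
    rw [key]
    exact Subtype.property _

variable (R H)

/-- `A` is a left `H`-module algebra: a left `H`-module and an `R`-algebra, with compatible
actions of `R`, such that `h (a b) = ∑ (h₁ a) (h₂ b)` and `h 1 = ε(h) 1`. -/
class IsModuleAlgebra (A : Type w) [Ring A] [Algebra R A] [Module H A] : Prop
    extends IsScalarTower R H A where
  smul_mul : ∀ (h : H) (a b : A), h • (a * b) = LinearMap.mul' R A
    (TensorProduct.map ((LinearMap.toSpanSingleton H A a).restrictScalars R)
      ((LinearMap.toSpanSingleton H A b).restrictScalars R) (Coalgebra.comul (R := R) h))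
  smul_one : ∀ h : H, h • (1 : A) = algebraMap R A (Coalgebra.counit h)

/-- A right `H`-comodule algebra: an `R`-algebra `B` with a coassociative and counital coaction
`B → B ⊗ H` which is a morphism of algebras. -/
class RightComoduleAlgebra (B : Type w) [Ring B] [Algebra R B] where
  coact : B →ₐ[R] B ⊗[R] H
  coassoc : ∀ b, TensorProduct.assoc R B H H (coact.toLinearMap.rTensor H (coact b)) =
    (Coalgebra.comul (R := R) (A := H)).lTensor B (coact b)
  counit : ∀ b, (Coalgebra.counit (R := R) (A := H)).lTensor B (coact b) = b ⊗ₜ[R] 1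

/-! ### The left smash product -/

section LeftSmash

variable (A : Type w) [Ring A] [Algebra R A] [Module H A] [IsModuleAlgebra R H A]

/-- The underlying module `A ⊗ H` of the left smash product `A # H`. -/
def LeftSmash (R : Type u) [CommRing R] (H : Type v) [Ring H] [Bialgebra R H] (A : Type w)
    [Ring A] [Algebra R A] [Module H A] [IsModuleAlgebra R H A] : Type (max w v) := A ⊗[R] H

namespace LeftSmash

instance : AddCommGroup (LeftSmash R H A) := inferInstanceAs (AddCommGroup (A ⊗[R] H))
instance : Module R (LeftSmash R H A) := inferInstanceAs (Module R (A ⊗[R] H))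

/-- The identity `A ⊗ H = A # H` as a linear equivalence. -/
def mk : A ⊗[R] H ≃ₗ[R] LeftSmash R H A := LinearEquiv.refl R (A ⊗[R] H)

variable {H A} in
/-- The map `h ↦ h a`. -/
def actOn (a : A) : H →ₗ[R] A := (LinearMap.toSpanSingleton H A a).restrictScalars R

variable {H A} in
@[simp] lemma actOn_apply (a : A) (h : H) : actOn R a h = h • a := rfl

/-- The map `h, b ↦ ∑ (h₁ b) # h₂`. -/
def twist : H →ₗ[R] A →ₗ[R] A ⊗[R] H :=
  LinearMap.mk₂ R (fun h b => (actOn R b).rTensor H (Coalgebra.comul (R := R) h))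
    (by intros; simp) (by intros; simp)
    (by
      intro h b c
      have : actOn (R := R) (H := H) (b + c) = actOn R b + actOn R c := by ext; simp
      simp [this])
    (by
      intro r h b
      have : actOn (R := R) (H := H) (r • b) = r • actOn R b := by
        ext x; simpa using smul_algebra_smul_comm r x b
      simp [this])

variable {H A} in
lemma twist_apply (h : H) (b : A) :
    twist R H A h b = (actOn R b).rTensor H (Coalgebra.comul (R := R) h) := rfl

/-- For fixed `a, h`, the map `b # k ↦ ∑ a (h₁ b) # h₂ k`. -/
def mulAux (a : A) (h : H) : A ⊗[R] H →ₗ[R] A ⊗[R] H :=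
  TensorProduct.lift (LinearMap.mk₂ R
    (fun b k => TensorProduct.map (LinearMap.mulLeft R a) (LinearMap.mulRight R k)
      (twist R H A h b))
    (by intros; simp) (by intros; simp)
    (by
      intro b k l
      have : LinearMap.mulRight R (k + l) = LinearMap.mulRight R k + LinearMap.mulRight R l := by
        ext; simp [mul_add]
      simp [this, TensorProduct.map_add_right])
    (by
      intro r b k
      have : LinearMap.mulRight R (r • k) = r • LinearMap.mulRight R k := by
        ext; simp
      simp [this, TensorProduct.map_smul_right]))

variable {H A} in
lemma mulAux_tmul (a : A) (h : H) (b : A) (k : H) :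
    mulAux R H A a h (b ⊗ₜ k) = TensorProduct.map (LinearMap.mulLeft R a ∘ₗ actOn R b)
      (LinearMap.mulRight R k) (Coalgebra.comul (R := R) h) := by
  simp only [mulAux, TensorProduct.lift.tmul, LinearMap.mk₂_apply, twist_apply]
  rw [← LinearMap.comp_apply, LinearMap.map_comp_rTensor]

/-- The multiplication `(a # h) (b # k) = ∑ a (h₁ b) # h₂ k`. -/
def mulMap : A ⊗[R] H →ₗ[R] A ⊗[R] H →ₗ[R] A ⊗[R] H :=
  TensorProduct.lift (LinearMap.mk₂ R (mulAux R H A)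
    (by
      intros a b h
      ext c k
      have : LinearMap.mulLeft R (a + b) = LinearMap.mulLeft R a + LinearMap.mulLeft R b := by
        ext; simp [add_mul]
      simp [mulAux_tmul, this, LinearMap.add_comp, TensorProduct.map_add_left])
    (by
      intros r a h
      ext c k
      have : LinearMap.mulLeft R (r • a) = r • LinearMap.mulLeft R a := by
        ext; simp
      simp [mulAux_tmul, this, LinearMap.smul_comp, TensorProduct.map_smul_left])
    (by intros; ext; simp [mulAux_tmul])
    (by intros; ext; simp [mulAux_tmul]))

variable {R H A}

lemma mulMap_tmul (a : A) (h : H) (b : A) (k : H) :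
    mulMap R H A (a ⊗ₜ h) (b ⊗ₜ k) = TensorProduct.map (LinearMap.mulLeft R a ∘ₗ actOn R b)
      (LinearMap.mulRight R k) (Coalgebra.comul (R := R) h) := by
  simp [mulMap, mulAux_tmul]

lemma smul_mul_repr {ι : Type*} (h : H) (r : Coalgebra.Repr R h ι) (a b : A) :
    h • (a * b) = ∑ i ∈ r.index, (r.left i • a) * (r.right i • b) := by
  rw [IsModuleAlgebra.smul_mul (R := R), ← r.eq]
  simp

lemma mulMap_repr {ι : Type*} (a : A) (h : H) (r : Coalgebra.Repr R h ι) (b : A) (k : H) :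
    mulMap R H A (a ⊗ₜ h) (b ⊗ₜ k) =
      ∑ i ∈ r.index, (a * (r.left i • b)) ⊗ₜ (r.right i * k) := by
  rw [mulMap_tmul, ← r.eq]
  simp

open Coalgebra in
lemma mulMap_assoc (x y z : A ⊗[R] H) :
    mulMap R H A (mulMap R H A x y) z = mulMap R H A x (mulMap R H A y z) := by
  induction x with
  | zero => simp
  | add x x' hx hx' => simp [hx, hx']
  | tmul a h =>
  induction y with
  | zero => simp
  | add y y' hy hy' => simp [hy, hy']
  | tmul b k =>
  induction z with
  | zero => simp
  | add z z' hz hz' => simp [hz, hz']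
  | tmul c l =>
  rw [mulMap_repr a h (ℛ R h), mulMap_repr b k (ℛ R k)]
  simp only [map_sum, LinearMap.sum_apply]
  have hL : ∀ i ∈ (ℛ R h).index,
      mulMap R H A ((a * ((ℛ R h).left i • b)) ⊗ₜ ((ℛ R h).right i * k)) (c ⊗ₜ l) =
      ∑ j ∈ (ℛ R k).index, ∑ m ∈ (ℛ R ((ℛ R h).right i)).index,
        (a * ((ℛ R h).left i • b) * (((ℛ R ((ℛ R h).right i)).left m * (ℛ R k).left j) • c)) ⊗ₜ
          ((ℛ R ((ℛ R h).right i)).right m * (ℛ R k).right j * l) := by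
    intro i _
    rw [mulMap_tmul, Bialgebra.comul_mul, ← (ℛ R k).eq, ← (ℛ R ((ℛ R h).right i)).eq,
      Finset.sum_mul_sum, Finset.sum_comm]
    simp [mul_assoc]
  rw [Finset.sum_congr rfl hL, Finset.sum_comm]
  refine Finset.sum_congr rfl fun j _ => ?_
  rw [mulMap_repr a h (ℛ R h)]
  let Φ : H ⊗[R] (H ⊗[R] H) →ₗ[R] A ⊗[R] H :=
    TensorProduct.map (LinearMap.mulLeft R a ∘ₗ LinearMap.mul' R A) (LinearMap.mulRight R l) ∘ₗ
    (TensorProduct.assoc R A A H).symm.toLinearMap ∘ₗ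
    TensorProduct.map (actOn R b) (TensorProduct.map
      (actOn R c ∘ₗ LinearMap.mulRight R ((ℛ R k).left j))
      (LinearMap.mulRight R ((ℛ R k).right j)))
  have key := congrArg Φ (sum_tmul_tmul_eq (ℛ R h) (fun i => ℛ R ((ℛ R h).left i))
    (fun i => ℛ R ((ℛ R h).right i)))
  simp only [map_sum] at key
  simp only [Φ, LinearMap.comp_apply, TensorProduct.map_tmul, LinearEquiv.coe_coe,
    TensorProduct.assoc_symm_tmul, LinearMap.mul'_apply, LinearMap.mulLeft_apply,
    LinearMap.mulRight_apply, actOn_apply] at key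
  simp only [mul_assoc] at key ⊢
  rw [← key]
  refine Finset.sum_congr rfl fun i _ => ?_
  rw [smul_mul_repr _ (ℛ R ((ℛ R h).left i)), Finset.mul_sum, TensorProduct.sum_tmul]
  simp [mul_smul]

instance : Mul (LeftSmash R H A) := ⟨fun x y => mulMap R H A x y⟩
instance : One (LeftSmash R H A) := ⟨(1 : A) ⊗ₜ[R] (1 : H)⟩

lemma mul_def (x y : LeftSmash R H A) : x * y = mulMap R H A x y := rfl
lemma one_def : (1 : LeftSmash R H A) = (1 : A) ⊗ₜ[R] (1 : H) := rfl

open Coalgebra in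
lemma mulMap_one (x : A ⊗[R] H) : mulMap R H A x ((1 : A) ⊗ₜ[R] (1 : H)) = x := by
  induction x with
  | zero => simp
  | add x x' hx hx' => simp [hx, hx']
  | tmul a h =>
  rw [mulMap_repr a h (ℛ R h)]
  have key := congrArg (TensorProduct.map (LinearMap.mulLeft R a ∘ₗ Algebra.linearMap R A)
    (LinearMap.id (M := H))) (sum_counit_tmul_eq (ℛ R h))
  simp only [map_sum, TensorProduct.map_tmul] at key
  simpa [IsModuleAlgebra.smul_one (R := R)] using key

lemma one_mulMap (x : A ⊗[R] H) : mulMap R H A ((1 : A) ⊗ₜ[R] (1 : H)) x = x := by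
  induction x with
  | zero => simp
  | add x x' hx hx' => simp [hx, hx']
  | tmul a h => simp [mulMap_tmul, Algebra.TensorProduct.one_def]

instance : Ring (LeftSmash R H A) where
  __ := (inferInstance : AddCommGroup (LeftSmash R H A))
  left_distrib x y z := map_add (mulMap R H A x) y z
  right_distrib x y z := LinearMap.map_add₂ (mulMap R H A) x y z
  zero_mul x := LinearMap.map_zero₂ (mulMap R H A) x
  mul_zero x := map_zero (mulMap R H A x)
  mul_assoc := mulMap_assoc
  one_mul := one_mulMap
  mul_one := mulMap_one

instance : Algebra R (LeftSmash R H A) :=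
  Algebra.ofModule (fun r x y => LinearMap.map_smul₂ (mulMap R H A) r x y)
    (fun r x y => map_smul (mulMap R H A x) r y)

variable (R H A) in
/-- The `H`-coaction `id ⊗ Δ` on `A # H`. -/
def coactMap : LeftSmash R H A →ₗ[R] LeftSmash R H A ⊗[R] H :=
  (mk R H A).toLinearMap.rTensor H ∘ₗ (TensorProduct.assoc R A H H).symm.toLinearMap ∘ₗ
    (Coalgebra.comul (R := R)).lTensor A ∘ₗ (mk R H A).symm.toLinearMap

/-- The element `a # h` of `A # H`. -/
def tmul (a : A) (h : H) : LeftSmash R H A := mk R H A (a ⊗ₜ[R] h)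

lemma coactMap_tmul {ι : Type*} (a : A) (h : H) (r : Coalgebra.Repr R h ι) :
    coactMap R H A (tmul a h) = ∑ i ∈ r.index, tmul a (r.left i) ⊗ₜ[R] r.right i := by
  simp [coactMap, tmul, ← r.eq, TensorProduct.tmul_sum]

open Coalgebra in
lemma tmul_mul_tmul {ι : Type*} (a : A) (h : H) (r : Coalgebra.Repr R h ι) (b : A) (k : H) :
    (tmul a h * tmul b k : LeftSmash R H A) =
      ∑ i ∈ r.index, tmul (a * (r.left i • b)) (r.right i * k) :=
  mulMap_repr a h r b k

lemma induction_on {p : LeftSmash R H A → Prop} (x : LeftSmash R H A) (h0 : p 0)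
    (ht : ∀ a h, p (tmul a h)) (ha : ∀ x y, p x → p y → p (x + y)) : p x :=
  TensorProduct.induction_on x h0 ht ha

open Coalgebra in
lemma coactMap_mul (x y : LeftSmash R H A) :
    coactMap R H A (x * y) = coactMap R H A x * coactMap R H A y := by
  induction x using induction_on with
  | h0 => simp
  | ha x x' hx hx' => simp [hx, hx', add_mul]
  | ht a h =>
  induction y using induction_on with
  | h0 => simp
  | ha y y' hy hy' => simp [hy, hy', mul_add]
  | ht b k =>
  let Ψ : A ⊗[R] (H ⊗[R] H) →ₗ[R] LeftSmash R H A ⊗[R] H :=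
    (mk R H A).toLinearMap.rTensor H ∘ₗ (TensorProduct.assoc R A H H).symm.toLinearMap
  have hΨ : ∀ a h k, Ψ (a ⊗ₜ (h ⊗ₜ k)) = tmul a h ⊗ₜ[R] k := fun _ _ _ => rfl
  have hc : ∀ a h, coactMap R H A (tmul a h) = Ψ (a ⊗ₜ comul h) := fun _ _ => rfl
  rw [coactMap_tmul a h (ℛ R h), coactMap_tmul b k (ℛ R k), tmul_mul_tmul a h (ℛ R h),
    Finset.sum_mul_sum, map_sum]
  have hL : ∀ i ∈ (ℛ R h).index,
      coactMap R H A (tmul (a * ((ℛ R h).left i • b)) ((ℛ R h).right i * k)) =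
      ∑ j ∈ (ℛ R k).index, ∑ m ∈ (ℛ R ((ℛ R h).right i)).index,
        tmul (a * ((ℛ R h).left i • b)) ((ℛ R ((ℛ R h).right i)).left m * (ℛ R k).left j) ⊗ₜ[R]
          ((ℛ R ((ℛ R h).right i)).right m * (ℛ R k).right j) := by
    intro i _
    rw [hc, Bialgebra.comul_mul, ← (ℛ R k).eq, ← (ℛ R ((ℛ R h).right i)).eq,
      Finset.sum_mul_sum, Finset.sum_comm]
    simp only [TensorProduct.tmul_sum, map_sum, Algebra.TensorProduct.tmul_mul_tmul, hΨ]
  rw [Finset.sum_congr rfl hL, Finset.sum_comm, Finset.sum_comm (s := (ℛ R h).index)]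
  refine Finset.sum_congr rfl fun j _ => ?_
  let Φ : H ⊗[R] (H ⊗[R] H) →ₗ[R] LeftSmash R H A ⊗[R] H := Ψ ∘ₗ
    TensorProduct.map (LinearMap.mulLeft R a ∘ₗ actOn R b) (TensorProduct.map
      (LinearMap.mulRight R ((ℛ R k).left j)) (LinearMap.mulRight R ((ℛ R k).right j)))
  have key := congrArg Φ (sum_tmul_tmul_eq (ℛ R h) (fun i => ℛ R ((ℛ R h).left i))
    (fun i => ℛ R ((ℛ R h).right i)))
  simp only [map_sum] at key
  simp only [Φ, LinearMap.comp_apply, TensorProduct.map_tmul, hΨ, LinearMap.mulLeft_apply,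
    LinearMap.mulRight_apply, actOn_apply] at key
  rw [← key]
  refine Finset.sum_congr rfl fun i _ => ?_
  rw [Algebra.TensorProduct.tmul_mul_tmul, tmul_mul_tmul _ _ (ℛ R ((ℛ R h).left i)),
    TensorProduct.sum_tmul]

/-- `A # H` is a right `H`-comodule algebra through `id ⊗ Δ`. -/
instance : RightComoduleAlgebra R H (LeftSmash R H A) where
  coact := AlgHom.ofLinearMap (coactMap R H A)
    (by
      change coactMap R H A (tmul 1 1) = tmul 1 1 ⊗ₜ[R] 1
      simp [coactMap, tmul, Algebra.TensorProduct.one_def])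
    coactMap_mul
  coassoc := by
    intro x
    induction x using induction_on with
    | h0 => simp
    | ha x x' hx hx' => simp only [map_add, hx, hx']
    | ht a h =>
    let Ψ : A ⊗[R] (H ⊗[R] (H ⊗[R] H)) →ₗ[R] LeftSmash R H A ⊗[R] (H ⊗[R] H) :=
      (mk R H A).toLinearMap.rTensor (H ⊗[R] H) ∘ₗ
        (TensorProduct.assoc R A H (H ⊗[R] H)).symm.toLinearMap
    have hΨ : ∀ a h k, Ψ (a ⊗ₜ (h ⊗ₜ k)) = tmul a h ⊗ₜ[R] k := fun _ _ _ => rfl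
    have key := congrArg (fun t => Ψ (a ⊗ₜ t)) (Coalgebra.sum_tmul_tmul_eq (.arbitrary R h)
      (fun i => .arbitrary R ((Coalgebra.Repr.arbitrary R h).left i))
      (fun i => .arbitrary R ((Coalgebra.Repr.arbitrary R h).right i)))
    simp only [map_sum, TensorProduct.tmul_sum, hΨ] at key
    simp only [AlgHom.ofLinearMap_apply, AlgHom.toLinearMap_ofLinearMap]
    rw [coactMap_tmul a h (.arbitrary R h)]
    simp only [map_sum, LinearMap.rTensor_tmul, LinearMap.lTensor_tmul]
    convert key using 2 with i _ i _
    · rw [coactMap_tmul a _ (.arbitrary R _)]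
      simp [TensorProduct.sum_tmul]
    · conv_lhs => rw [← (Coalgebra.Repr.arbitrary R ((Coalgebra.Repr.arbitrary R h).right i)).eq]
      simp [TensorProduct.tmul_sum]
  counit := by
    intro x
    induction x using induction_on with
    | h0 => simp
    | ha x x' hx hx' => simp only [map_add, hx, hx', TensorProduct.add_tmul]
    | ht a h =>
    let Ψ : A ⊗[R] (H ⊗[R] R) →ₗ[R] LeftSmash R H A ⊗[R] R :=
      (mk R H A).toLinearMap.rTensor R ∘ₗ (TensorProduct.assoc R A H R).symm.toLinearMap
    have hΨ : ∀ a h k, Ψ (a ⊗ₜ (h ⊗ₜ k)) = tmul a h ⊗ₜ[R] k := fun _ _ _ => rfl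
    have key := congrArg (fun t => Ψ (a ⊗ₜ t))
      (Coalgebra.sum_tmul_counit_eq (Coalgebra.Repr.arbitrary R h))
    simp only [map_sum, TensorProduct.tmul_sum, hΨ] at key
    simp only [AlgHom.ofLinearMap_apply]
    rw [coactMap_tmul a h (.arbitrary R h)]
    simpa only [map_sum, LinearMap.lTensor_tmul] using key

end LeftSmash
end LeftSmash

/-! ### The right smash product -/

variable {R H}

section RightSmash

/-- The underlying module `B ⊗ U` of the right smash product `B # U` of a right `H`-comodule
algebra `B` and a right `H`-module subalgebra `U` of `H*`. -/
def RightSmash (R : Type u) [CommRing R] (H : Type v) [Ring H] [Bialgebra R H] (B : Type w)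
    [Ring B] [Algebra R B] [RightComoduleAlgebra R H B] (U : Submodule R (H →ₗ[R] R))
    [IsRightModuleSubalgebra U] : Type (max w u v) := B ⊗[R] U

namespace RightSmash

lemma conv_repr {ι : Type*} (f g : H →ₗ[R] R) (h : H) (r : Coalgebra.Repr R h ι) :
    conv f g h = ∑ i ∈ r.index, f (r.left i) * g (r.right i) :=
  r.convMul_apply (WithConv.toConv f) (WithConv.toConv g)

lemma conv_assoc (f g k : H →ₗ[R] R) : conv (conv f g) k = conv f (conv g k) := by
  simp only [conv, WithConv.toConv_ofConv, mul_assoc]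

lemma conv_counit (f : H →ₗ[R] R) : conv f (Coalgebra.counit : H →ₗ[R] R) = f :=
  congrArg WithConv.ofConv (mul_one (WithConv.toConv f))

lemma counit_conv (f : H →ₗ[R] R) : conv (Coalgebra.counit : H →ₗ[R] R) f = f :=
  congrArg WithConv.ofConv (one_mul (WithConv.toConv f))

lemma conv_add (f g k : H →ₗ[R] R) : conv f (g + k) = conv f g + conv f k := by
  simp [conv, mul_add]

lemma add_conv (f g k : H →ₗ[R] R) : conv (f + g) k = conv f k + conv g k := by
  simp [conv, add_mul]

lemma conv_smul (r : R) (f g : H →ₗ[R] R) : conv f (r • g) = r • conv f g := by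
  rw [conv, WithConv.toConv_smul, mul_smul_comm]; rfl

lemma smul_conv (r : R) (f g : H →ₗ[R] R) : conv (r • f) g = r • conv f g := by
  rw [conv, WithConv.toConv_smul, smul_mul_assoc]; rfl

lemma rightAct_add (f : H →ₗ[R] R) (h k : H) :
    rightAct f (h + k) = rightAct f h + rightAct f k := by
  ext; simp [add_mul]

lemma rightAct_smul (r : R) (f : H →ₗ[R] R) (h : H) :
    rightAct f (r • h) = r • rightAct f h := by
  ext; simp

lemma add_rightAct (f g : H →ₗ[R] R) (h : H) :
    rightAct (f + g) h = rightAct f h + rightAct g h := by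
  ext; simp

lemma smul_rightAct (r : R) (f : H →ₗ[R] R) (h : H) :
    rightAct (r • f) h = r • rightAct f h := by
  ext; simp

lemma rightAct_mul (f : H →ₗ[R] R) (h k : H) :
    rightAct f (h * k) = rightAct (rightAct f h) k := by
  ext; simp [mul_assoc]

lemma rightAct_counit (h : H) : rightAct (Coalgebra.counit : H →ₗ[R] R) h =
    Coalgebra.counit (R := R) h • (Coalgebra.counit : H →ₗ[R] R) := by
  ext; simp

open Coalgebra in
lemma rightAct_conv {ι : Type*} (f g : H →ₗ[R] R) (h : H) (r : Coalgebra.Repr R h ι) :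
    rightAct (conv f g) h =
      ∑ i ∈ r.index, conv (rightAct f (r.left i)) (rightAct g (r.right i)) := by
  ext k
  rw [rightAct_apply, conv]
  rw [LinearMap.convMul_apply, Bialgebra.comul_mul, ← r.eq, ← (ℛ R k).eq,
    Finset.sum_mul_sum]
  simp [fun f g : H →ₗ[R] R => conv_repr f g k (ℛ R k)]

variable {U : Submodule R (H →ₗ[R] R)} [hU : IsRightModuleSubalgebra U]

/-- The map `h ↦ (f h) ⋆ g`, for `f, g` in `U`. -/
def actConv (f g : U) : H →ₗ[R] U where
  toFun h := ⟨conv (rightAct f h) g, hU.conv_mem _ (hU.act_mem _ f.2 h) _ g.2⟩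
  map_add' h k := by ext1; simp [rightAct_add, add_conv]
  map_smul' r h := by ext1; simp [rightAct_smul, smul_conv]

@[simp] lemma coe_actConv (f g : U) (h : H) :
    (actConv f g h : H →ₗ[R] R) = conv (rightAct f h) g := rfl

lemma actConv_add (f g k : U) : actConv f (g + k) = actConv f g + actConv f k := by
  ext1 h; ext1; simp [conv_add]

lemma actConv_smul (r : R) (f g : U) : actConv f (r • g) = r • actConv f g := by
  ext1 h; ext1; simp [conv_smul]

lemma add_actConv (f g k : U) : actConv (f + g) k = actConv f k + actConv g k := by
  ext1 h; ext1; simp [add_rightAct, add_conv]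

lemma smul_actConv (r : R) (f g : U) : actConv (r • f) g = r • actConv f g := by
  ext1 h; ext1; simp [smul_rightAct, smul_conv]

/-- Convolution on the right by `k`, as a linear map. -/
def convRight (k : H →ₗ[R] R) : (H →ₗ[R] R) →ₗ[R] (H →ₗ[R] R) where
  toFun f := conv f k
  map_add' _ _ := add_conv _ _ _
  map_smul' _ _ := smul_conv _ _ _

lemma sum_conv {ι : Type*} (s : Finset ι) (φ : ι → (H →ₗ[R] R)) (k : H →ₗ[R] R) :
    conv (∑ i ∈ s, φ i) k = ∑ i ∈ s, conv (φ i) k :=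
  map_sum (convRight k) φ s

variable (R H) {B : Type w} [Ring B] [Algebra R B] [RightComoduleAlgebra R H B]

/-- The coaction as a linear map. -/
def rho : B →ₗ[R] B ⊗[R] H := (RightComoduleAlgebra.coact (R := R) (H := H) (B := B)).toLinearMap

variable (U B)

/-- For fixed `b, f`, the map `c # g ↦ ∑ b c₀ # (f c₁) ⋆ g`. -/
def mulAux (b : B) (f : U) : B ⊗[R] U →ₗ[R] B ⊗[R] U :=
  TensorProduct.lift (LinearMap.mk₂ R
    (fun c g => TensorProduct.map (LinearMap.mulLeft R b) (actConv f g) (rho R H c))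
    (by intros; simp) (by intros; simp)
    (by intros; simp [actConv_add, TensorProduct.map_add_right])
    (by intros; simp [actConv_smul, TensorProduct.map_smul_right]))

/-- The multiplication `(b # f) (c # g) = ∑ b c₀ # (f c₁) ⋆ g`. -/
def mulMap : B ⊗[R] U →ₗ[R] B ⊗[R] U →ₗ[R] B ⊗[R] U :=
  TensorProduct.lift (LinearMap.mk₂ R (mulAux R H U B)
    (by
      intros a b f
      ext c g
      have : LinearMap.mulLeft R (a + b) = LinearMap.mulLeft R a + LinearMap.mulLeft R b := by
        ext; simp [add_mul]
      simp [mulAux, this, TensorProduct.map_add_left])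
    (by
      intros r a f
      ext c g
      have : LinearMap.mulLeft R (r • a) = r • LinearMap.mulLeft R a := by
        ext; simp
      simp [mulAux, this, TensorProduct.map_smul_left])
    (by intros; ext; simp [mulAux, add_actConv, TensorProduct.map_add_right])
    (by intros; ext; simp [mulAux, smul_actConv, TensorProduct.map_smul_right]))

variable {R H U B}

lemma mulMap_tmul (b : B) (f : U) (c : B) (g : U) :
    mulMap R H U B (b ⊗ₜ f) (c ⊗ₜ g) =
      TensorProduct.map (LinearMap.mulLeft R b) (actConv f g) (rho R H c) := by
  simp [mulMap, mulAux]

lemma mulMap_assoc (x y z : B ⊗[R] U) :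
    mulMap R H U B (mulMap R H U B x y) z = mulMap R H U B x (mulMap R H U B y z) := by
  induction x with
  | zero => simp
  | add x x' hx hx' => simp [hx, hx']
  | tmul b f =>
  induction y with
  | zero => simp
  | add y y' hy hy' => simp [hy, hy']
  | tmul c g =>
  induction z with
  | zero => simp
  | add z z' hz hz' => simp [hz, hz']
  | tmul d k =>
  have hmul : ∀ c d : B, rho R H (c * d) = rho R H c * rho R H d := fun c d =>
    map_mul (RightComoduleAlgebra.coact (R := R) (H := H) (B := B)) c d
  have hco : TensorProduct.assoc R B H H ((rho R H).rTensor H (rho R H d)) =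
      (Coalgebra.comul (R := R) (A := H)).lTensor B (rho R H d) :=
    RightComoduleAlgebra.coassoc (R := R) (H := H) d
  obtain ⟨S, hS⟩ := TensorProduct.exists_finset (rho R H c)
  let Θ : H → H ⊗[R] H →ₗ[R] U := fun x => TensorProduct.lift (LinearMap.mk₂ R
    (fun s t => actConv f (actConv g k t) (x * s))
    (by intros; simp [mul_add]) (by intros; simp)
    (by intros; simp [actConv_add]) (by intros; simp [actConv_smul]))
  let Φ : B × H → B ⊗[R] (H ⊗[R] H) →ₗ[R] B ⊗[R] U := fun p =>
    TensorProduct.map (LinearMap.mulLeft R (b * p.1)) (Θ p.2)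
  have h1 : ∀ (p : B × H) (t : B ⊗[R] H),
      TensorProduct.map (LinearMap.mulLeft R (b * p.1)) (actConv (actConv f g p.2) k) t =
        Φ p ((Coalgebra.comul (R := R) (A := H)).lTensor B t) := by
    intro p t
    induction t with
    | zero => simp
    | add x y hx hy => simp only [map_add, hx, hy]
    | tmul x y =>
      simp only [LinearMap.lTensor_tmul, Φ, TensorProduct.map_tmul]
      congr 1
      ext1
      rw [coe_actConv, coe_actConv, rightAct_conv _ _ _ (.arbitrary R y),
        ← (Coalgebra.Repr.arbitrary R y).eq]
      simp only [map_sum, Θ, TensorProduct.lift.tmul, LinearMap.mk₂_apply,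
        Submodule.coe_sum, coe_actConv, rightAct_mul, sum_conv, conv_assoc]
  have h2 : ∀ t : B ⊗[R] H,
      mulMap R H U B (b ⊗ₜ f) (TensorProduct.map (LinearMap.mulLeft R c) (actConv g k) t) =
        ∑ p ∈ S, Φ p (TensorProduct.assoc R B H H ((rho R H).rTensor H t)) := by
    intro t
    induction t with
    | zero => simp
    | add x y hx hy => simp only [map_add, hx, hy, Finset.sum_add_distrib]
    | tmul x y =>
      simp only [TensorProduct.map_tmul, mulMap_tmul, LinearMap.rTensor_tmul,
        LinearMap.mulLeft_apply, hmul]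
      rw [hS, Finset.sum_mul, map_sum]
      refine Finset.sum_congr rfl fun p _ => ?_
      generalize rho R H x = t
      induction t with
      | zero => simp
      | add x y hx hy => simp only [map_add, mul_add, TensorProduct.add_tmul, hx, hy]
      | tmul x z => simp [Φ, Θ]
  rw [mulMap_tmul c, h2, mulMap_tmul b, hS, hco]
  simp only [map_sum, LinearMap.sum_apply, TensorProduct.map_tmul, mulMap_tmul,
    LinearMap.mulLeft_apply]
  exact Finset.sum_congr rfl fun p _ => h1 p _

instance : AddCommGroup (RightSmash R H B U) := inferInstanceAs (AddCommGroup (B ⊗[R] U))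
instance : Module R (RightSmash R H B U) := inferInstanceAs (Module R (B ⊗[R] U))

variable (R H B U) in
/-- The identity `B ⊗ U = B # U` as a linear equivalence. -/
def mk : B ⊗[R] U ≃ₗ[R] RightSmash R H B U := LinearEquiv.refl R (B ⊗[R] U)

instance : Mul (RightSmash R H B U) := ⟨fun x y => mulMap R H U B x y⟩
instance : One (RightSmash R H B U) := ⟨(1 : B) ⊗ₜ[R] (⟨Coalgebra.counit, hU.counit_mem⟩ : U)⟩

lemma mulMap_one (x : B ⊗[R] U) :
    mulMap R H U B x ((1 : B) ⊗ₜ[R] (⟨Coalgebra.counit, hU.counit_mem⟩ : U)) = x := by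
  induction x with
  | zero => simp
  | add x x' hx hx' => simp [hx, hx']
  | tmul b f =>
  have h1 : rho R H (1 : B) = 1 ⊗ₜ 1 :=
    map_one (RightComoduleAlgebra.coact (R := R) (H := H) (B := B))
  rw [mulMap_tmul, h1]
  simp only [TensorProduct.map_tmul, LinearMap.mulLeft_apply, mul_one]
  congr 1
  ext1
  rw [coe_actConv, conv_counit]
  ext
  simp

lemma one_mulMap (x : B ⊗[R] U) :
    mulMap R H U B ((1 : B) ⊗ₜ[R] (⟨Coalgebra.counit, hU.counit_mem⟩ : U)) x = x := by
  induction x with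
  | zero => simp
  | add x x' hx hx' => simp [hx, hx']
  | tmul b f =>
  have hc : (Coalgebra.counit (R := R) (A := H)).lTensor B (rho R H b) = b ⊗ₜ[R] 1 :=
    RightComoduleAlgebra.counit (R := R) (H := H) b
  have key := congrArg ((LinearMap.toSpanSingleton R U f).lTensor B) hc
  rw [mulMap_tmul]
  simp only [LinearMap.lTensor_tmul, LinearMap.toSpanSingleton_apply, one_smul] at key
  rw [← key]
  generalize rho R H b = t
  induction t with
  | zero => simp
  | add x y hx hy => simp only [map_add, hx, hy]
  | tmul x z =>
    simp only [TensorProduct.map_tmul, LinearMap.mulLeft_apply, one_mul, LinearMap.lTensor_tmul,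
      LinearMap.toSpanSingleton_apply]
    congr 1
    ext1
    rw [coe_actConv, rightAct_counit, smul_conv, counit_conv]
    rfl

instance : Ring (RightSmash R H B U) where
  __ := (inferInstance : AddCommGroup (RightSmash R H B U))
  left_distrib x y z := map_add (mulMap R H U B x) y z
  right_distrib x y z := LinearMap.map_add₂ (mulMap R H U B) x y z
  zero_mul x := LinearMap.map_zero₂ (mulMap R H U B) x
  mul_zero x := map_zero (mulMap R H U B x)
  mul_assoc := mulMap_assoc
  one_mul := one_mulMap
  mul_one := mulMap_one

instance : Algebra R (RightSmash R H B U) :=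
  Algebra.ofModule (fun r x y => LinearMap.map_smul₂ (mulMap R H U B) r x y)
    (fun r x y => map_smul (mulMap R H U B x) r y)

end RightSmash
end RightSmash

/-! ## Twisted antipodes, the RL-condition, local finiteness, coefficients -/

/-- `T` is a twisted antipode of `H`, that is, an antipode of the bialgebra with the opposite
multiplication: `∑ T(h₂) h₁ = ε(h) 1 = ∑ h₂ T(h₁)`. -/
structure IsTwistedAntipode (T : H →ₗ[R] H) : Prop where
  left : LinearMap.mul' R H ∘ₗ TensorProduct.map T LinearMap.id ∘ₗ
    (TensorProduct.comm R H H).toLinearMap ∘ₗ Coalgebra.comul =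
      Algebra.linearMap R H ∘ₗ Coalgebra.counit
  right : LinearMap.mul' R H ∘ₗ TensorProduct.map LinearMap.id T ∘ₗ
    (TensorProduct.comm R H H).toLinearMap ∘ₗ Coalgebra.comul =
      Algebra.linearMap R H ∘ₗ Coalgebra.counit

/-- The left action `f ⇀ k = ∑ k₁ f(k₂)`. -/
def leftHit (f : H →ₗ[R] R) : H →ₗ[R] H :=
  (TensorProduct.rid R H).toLinearMap ∘ₗ f.lTensor H ∘ₗ Coalgebra.comul

/-- The right action `k ↼ g = ∑ g(k₁) k₂`. -/
def rightHit (g : H →ₗ[R] R) : H →ₗ[R] H :=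
  (TensorProduct.lid R H).toLinearMap ∘ₗ g.rTensor H ∘ₗ Coalgebra.comul

/-- `(V, U)` satisfies the RL-condition with respect to `H`: for every `g ∈ V` there are finitely
many pairs `(hⱼ, gⱼ) ∈ H × U` such that `k ↼ g = ∑ hⱼ (gⱼ ⇀ k)` for all `k`. -/
def RLCondition (V U : Submodule R (H →ₗ[R] R)) : Prop :=
  ∀ g ∈ V, ∃ (n : ℕ) (h : Fin n → H) (f : Fin n → (H →ₗ[R] R)), (∀ j, f j ∈ U) ∧
    ∀ k : H, rightHit g k = ∑ j, h j * leftHit (f j) k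

section Action

variable (U : Submodule R (H →ₗ[R] R)) (A : Type w) [Ring A] [Algebra R A] [Module H A]

/-- `A` is `U`-locally finite: for every `a` there is a finite subset of `U` the common kernel of
which annihilates `a`. -/
def IsLocallyFinite : Prop :=
  ∀ a : A, ∃ F : Finset (H →ₗ[R] R), (F : Set (H →ₗ[R] R)) ⊆ U ∧
    ∀ h : H, (∀ f ∈ F, f h = 0) → h • a = 0

variable {A} in
/-- `t = ∑ a₀ ⊗ a₁ ∈ A ⊗ U` is the value at `a` of the `U`-coaction on `A` induced by the action
of `H`: `h a = ∑ a₁(h) a₀` for all `h`. -/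
def IsCoactionValue (a : A) (t : A ⊗[R] U) : Prop :=
  ∀ h : H, alphaMap U A t h = h • a

/-- `C` is a coefficient submodule of `A` for the induced `U`-coaction `ϱ`: a submodule of `U`
such that `ϱ(a)` lies in the image of `A ⊗ C` for all `a`, that is, `ϱ(a)` can be written as
`∑ a₀ ⊗ a₁` with all `a₁` in `C`. -/
structure IsCoefficientSubmodule (C : Submodule R (H →ₗ[R] R)) : Prop where
  le : C ≤ U
  mem_range : ∀ (a : A) (t : A ⊗[R] U), IsCoactionValue U a t →
    t ∈ LinearMap.range ((Submodule.inclusion le).lTensor A)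

end Action

end Bialgebra

end HopfDuality

end

open HopfDuality

/-! Both algebras are identified with the same algebra of endomorphisms of one module. For a
comodule algebra `B` the smash product `B # U` acts on `B` by `(b # f) c = b (f ⇀ c)`. Take `B = A #
H` on one side. On the other let `L` be the image of `H # U` in `End(H)`, and let `A ⊗ L` act on `A
⊗ H` through left multiplication on `A` and evaluation on `H`. The twisted antipode makes `θ : A ⊗ H
→ A # H`, `b ⊗ k ↦ ∑ k₁ b # k₂ = (1 # k)(b # 1)`, bijective (`twistEquiv`), and the two actions are
compared along `θ`.

Faithfulness: evaluating either action at the elements `1 # k`, respectively `1 ⊗ k`, turns a tensor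
`(a ⊗ h) ⊗ f` into `k ↦ ∑ a ⊗ h k₁ f(k₂)`. This is the canonical map `(A ⊗ H) ⊗ U → Hom(H, A ⊗ H)`
followed by an operator that the twisted antipode inverts. The canonical map is injective because
`U` is pure in `R ^ H` and `R` is Noetherian (`alphaMap_injective`).

Equality of images (`range_smashAct_eq`): under `θ` the element `(1 # h) # f` acts as `id ⊗ (h #
f)`, left multiplication by `a # 1` becomes `∑ a₀ ⊗ (· ↼ (a₁ ∘ T))`, and conversely `a ⊗ id` becomes
`∑ (a₀ # 1) θ (id ⊗ (· ↼ a₁)) θ⁻¹`. The RL-condition says exactly that the operators `· ↼ g` with `g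
∈ V` lie in `L`, and `V` contains both `a₁` and `a₁ ∘ T`.

Density of `L` (`isFinitelyDense_range_smashAct`): the operator above is invertible on `End(H)` and
its values depend on finitely many values of its argument, so density of `H ⊗ U` in `Hom(H, H)`
suffices. That follows from density of `U` in `H*` by a dual basis of the projective module `H`. In
the QF case self-injectivity shows that the point-separating module `H°` is dense in `H*`, and
density is transitive. -/

noncomputable section

namespace HopfDuality

universe u v w

/-! ### Purity and the canonical map `M ⊗ U → Hom(W, M)` -/

section AlphaCondition

variable {R : Type u} [CommRing R]

lemma exists_sum_tmul {M : Type v} {N : Type w} [AddCommMonoid M] [Module R M]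
    [AddCommMonoid N] [Module R N] (t : M ⊗[R] N) :
    ∃ (n : ℕ) (m : Fin n → M) (x : Fin n → N), t = ∑ i, m i ⊗ₜ[R] x i := by
  obtain ⟨S, hS⟩ := TensorProduct.exists_finset t
  let e := S.equivFin
  refine ⟨S.card, fun i => (e.symm i).1.1, fun i => (e.symm i).1.2, ?_⟩
  rw [hS, ← Finset.sum_coe_sort, ← e.symm.sum_comp]

/-- Over a Noetherian ring the canonical map `M ⊗ R ^ X → M ^ X` is injective. -/
lemma sum_tmul_fun_eq_zero [IsNoetherianRing R] {M : Type v} [AddCommGroup M] [Module R M]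
    {X : Type w} {n : ℕ} (m : Fin n → M) (g : Fin n → X → R)
    (h : ∀ x, ∑ i, g i x • m i = 0) : ∑ i, m i ⊗ₜ[R] g i = 0 := by
  -- `K` is the module of relations among the `m i`, finitely generated since `R` is Noetherian.
  -- Each tuple `(g i x)_i` is a relation; expanding it, point by point, in the generators `r j`
  -- exhibits the tensor as trivially vanishing.
  let K : Submodule R (Fin n → R) := LinearMap.ker (Fintype.linearCombination R m)
  obtain ⟨k, r, hr⟩ := Submodule.fg_iff_exists_fin_generating_family.mp
    (IsNoetherian.noetherian K)
  have hg : ∀ x, ∃ c : Fin k → R, ∑ j, c j • r j = fun i => g i x := by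
    intro x
    rw [← Submodule.mem_span_range_iff_exists_fun, hr]
    simpa [K, Fintype.linearCombination_apply] using h x
  choose c hc using hg
  refine TensorProduct.sum_tmul_eq_zero_of_vanishesTrivially R
    ⟨k, fun i j => r j i, fun j x => c x j, fun i => ?_, fun j => ?_⟩
  · ext x
    simpa [mul_comm] using (congrFun (hc x) i).symm
  · have : r j ∈ K := hr ▸ Submodule.subset_span ⟨j, rfl⟩
    simpa [K, Fintype.linearCombination_apply] using this

lemma alphaMap_tmul {W : Type v} [AddCommGroup W] [Module R W] (U : Submodule R (W →ₗ[R] R))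
    {M : Type w} [AddCommGroup M] [Module R M] (m : M) (f : U) (x : W) :
    alphaMap U M (m ⊗ₜ f) x = (f : W →ₗ[R] R) x • m := by
  simp [alphaMap]

/-- If `U ⊆ W*` is pure in `R ^ W`, then `M ⊗ U → Hom(W, M)` is injective for all `M`. -/
lemma alphaMap_injective_of_isPure [IsNoetherianRing R] {W : Type v} [AddCommGroup W] [Module R W]
    {U : Submodule R (W →ₗ[R] R)} (hU : IsPure (LinearMap.ltoFun R W R R ∘ₗ U.subtype))
    (M : Type w) [AddCommGroup M] [Module R M] : Function.Injective (alphaMap U M) := by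
  rw [injective_iff_map_eq_zero]
  intro t ht
  obtain ⟨n, m, f, rfl⟩ := exists_sum_tmul t
  -- Purity is available only for modules in the universe of `R`, so `M` is replaced by the span of
  -- the `m i`, realized as the quotient of `R ^ n` by the relations. The tensor already vanishes
  -- there, and `p` carries this back to `M`.
  let K : Submodule R (Fin n → R) := LinearMap.ker (Fintype.linearCombination R m)
  let p : (Fin n → R) ⧸ K →ₗ[R] M := K.liftQ (Fintype.linearCombination R m) le_rfl
  have hp : Function.Injective p := LinearMap.ker_eq_bot.mp (Submodule.ker_liftQ_eq_bot' _ _ rfl)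
  let e : Fin n → (Fin n → R) ⧸ K := fun i => K.mkQ (Pi.single i 1)
  have he : ∀ i, p (e i) = m i := fun i => by
    simp [p, e, Fintype.linearCombination_apply_single]
  have h0 : ∑ i, e i ⊗ₜ[R] (fun x => (f i : W →ₗ[R] R) x) = 0 := by
    refine sum_tmul_fun_eq_zero e _ fun x => hp ?_
    simpa [he, alphaMap_tmul] using LinearMap.congr_fun ht x
  have h1 : (∑ i, e i ⊗ₜ[R] f i : ((Fin n → R) ⧸ K) ⊗[R] U) = 0 := by
    refine (TensorProduct.comm R _ _).injective (hU _ ?_)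
    simpa using! congrArg (TensorProduct.comm R _ _) h0
  simpa [he] using congrArg (p.rTensor U) h1

lemma IsPure.comp {K : Type*} {M : Type*} {N : Type*} [AddCommMonoid K] [Module R K]
    [AddCommMonoid M] [Module R M] [AddCommMonoid N] [Module R N]
    {g : M →ₗ[R] N} {f : K →ₗ[R] M} (hg : IsPure g) (hf : IsPure f) : IsPure (g ∘ₗ f) := by
  intro P _ _
  rw [LinearMap.rTensor_comp]
  exact (hg P).comp (hf P)

/-- Purity is transitive along `U ⊆ H° ⊆ R ^ H`. -/
lemma alphaMap_injective [IsNoetherianRing R] {H : Type v} [Ring H] [Bialgebra R H]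
    (hα : IsAlphaAlgebra R H) (U : Submodule R (H →ₗ[R] R)) [hU : IsSubbialgebra U]
    (M : Type w) [AddCommGroup M] [Module R M] : Function.Injective (alphaMap U M) := by
  have h : IsPure (LinearMap.ltoFun R H R R ∘ₗ (finiteDual R H).subtype) := hα
  refine alphaMap_injective_of_isPure ?_ M
  have h' := h.comp hU.pure
  rwa [LinearMap.comp_assoc, Submodule.subtype_comp_inclusion] at h'

lemma map_alphaMap {W : Type*} [AddCommGroup W] [Module R W] (U : Submodule R (W →ₗ[R] R))
    {M N : Type*} [AddCommGroup M] [Module R M] [AddCommGroup N] [Module R N] (p : M →ₗ[R] N)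
    (t : M ⊗[R] U) : alphaMap U N (p.rTensor U t) = p ∘ₗ alphaMap U M t := by
  induction t with
  | zero => simp
  | add x y hx hy => simp only [map_add, hx, hy, LinearMap.comp_add]
  | tmul m f => ext x; simp [alphaMap_tmul]

lemma alphaMap_inclusion {W : Type*} [AddCommGroup W] [Module R W]
    {C U : Submodule R (W →ₗ[R] R)} (h : C ≤ U) {M : Type*} [AddCommGroup M] [Module R M]
    (t : M ⊗[R] C) : alphaMap U M ((Submodule.inclusion h).lTensor M t) = alphaMap C M t := by
  induction t with
  | zero => simp
  | add s t hs ht => simp only [map_add, hs, ht]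
  | tmul m c => ext k; simp [alphaMap_tmul]

/-- A linear map that vanishes on the common kernel of finitely many elements of `U` comes from
`M ⊗ U`. -/
lemma exists_alphaMap_eq {W : Type v} [AddCommGroup W] [Module R W]
    {U : Submodule R (W →ₗ[R] R)}
    (hα : ∀ (M : Type u) [AddCommGroup M] [Module R M], Function.Injective (alphaMap U M))
    {M : Type w} [AddCommGroup M] [Module R M] (φ : W →ₗ[R] M) (F : Finset (W →ₗ[R] R))
    (hF : (F : Set (W →ₗ[R] R)) ⊆ U) (hφ : ∀ x, (∀ f ∈ F, f x = 0) → φ x = 0) :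
    ∃ t : M ⊗[R] U, alphaMap U M t = φ := by
  let e := F.equivFin
  let f : Fin F.card → U := fun i => ⟨(e.symm i).1, hF (e.symm i).2⟩
  let η : W →ₗ[R] (Fin F.card → R) := LinearMap.pi fun i => (f i).1
  let N := LinearMap.range η
  have hker : LinearMap.ker η ≤ LinearMap.ker φ := by
    intro x hx
    refine hφ x fun g hg => ?_
    simpa [η, f] using congrFun (LinearMap.mem_ker.mp hx) (e ⟨g, hg⟩)
  -- `φ` factors through the image `N` of `η`, so it is enough to represent `W → N` by an element of
  -- `N ⊗ U`.
  let q : N →ₗ[R] M := (LinearMap.ker η).liftQ φ hker ∘ₗ η.quotKerEquivRange.symm.toLinearMap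
  have hq : ∀ x, q (η.rangeRestrict x) = φ x := by
    intro x
    have : η.rangeRestrict x = η.quotKerEquivRange ((LinearMap.ker η).mkQ x) := by ext; rfl
    simp [q, this]
  -- `t₀` represents `η` itself. Since `η` dies in `R ^ n / N`, injectivity of the canonical map
  -- kills the image of `t₀` in `(R ^ n / N) ⊗ U`, and right exactness lifts `t₀` to `N ⊗ U`.
  let t₀ : (Fin F.card → R) ⊗[R] U := ∑ i, Pi.single i 1 ⊗ₜ f i
  have ht₀ : alphaMap U _ t₀ = η := by
    ext x i
    simp [t₀, alphaMap_tmul, η, Finset.sum_apply, Pi.single_apply]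
  have h0 : N.mkQ.rTensor U t₀ = 0 := by
    refine hα _ ?_
    rw [map_alphaMap, ht₀, map_zero]
    ext x
    simp [N]
  obtain ⟨t₁, ht₁⟩ := (rTensor_exact U (LinearMap.exact_subtype_mkQ N) N.mkQ_surjective t₀).mp h0
  refine ⟨q.rTensor U t₁, ?_⟩
  have h1 : alphaMap U N t₁ = η.rangeRestrict := by
    ext1 x
    ext1
    have := LinearMap.congr_fun (map_alphaMap U N.subtype t₁) x
    rw [ht₁, ht₀] at this
    exact this.symm
  ext x
  rw [map_alphaMap, h1, LinearMap.comp_apply, hq]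

end AlphaCondition

/-! ### Density in the finite topology -/

section Density

variable {R : Type u} [CommRing R]

/-- Over a self-injective Noetherian ring, a submodule of `W*` that separates the points of `W` is
dense in `W*`. -/
lemma isFinitelyDense_univ_of_separating [IsNoetherianRing R] (hR : Module.Injective R R)
    {W : Type v} [AddCommGroup W] [Module R W] (D : Submodule R (W →ₗ[R] R))
    (hD : ∀ x, (∀ f ∈ D, f x = 0) → x = 0) :
    IsFinitelyDense (D : Set (W →ₗ[R] R)) Set.univ := by
  intro f _ F
  let N : Submodule R W := Submodule.span R F
  have : Module.Finite R N := Module.Finite.span_of_finite R F.finite_toSet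
  obtain ⟨k, s, hs⟩ := Module.Finite.exists_fin' R N
  -- The dual of `N` embeds into the dual of `R ^ k`, hence is Noetherian, and the restrictions of
  -- `D` to `N` are spanned by finitely many `d i`.
  have : IsNoetherian R (N →ₗ[R] R) := isNoetherian_of_injective (s.lcomp R R) (by
    intro a b hab
    exact LinearMap.cancel_right hs |>.mp hab)
  let res : (W →ₗ[R] R) →ₗ[R] (N →ₗ[R] R) := N.subtype.lcomp R R
  obtain ⟨n, d, hd⟩ := Submodule.fg_iff_exists_fin_generating_family.mp
    (IsNoetherian.noetherian (D.map res))
  let δ : N →ₗ[R] (Fin n → R) := LinearMap.pi d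
  have hδ : Function.Injective δ := by
    rw [injective_iff_map_eq_zero]
    intro x hx
    ext1
    refine hD x fun g hg => ?_
    have hg' : res g ∈ Submodule.span R (Set.range d) := hd ▸ Submodule.mem_map_of_mem hg
    have hle : Submodule.span R (Set.range d) ≤ LinearMap.ker (LinearMap.applyₗ x) := by
      rw [Submodule.span_le]
      rintro _ ⟨i, rfl⟩
      exact congrFun hx i
    exact hle hg'
  let e := LinearEquiv.ofInjective δ hδ
  -- Since `D` separates points, `δ` embeds `N` in `R ^ n`. Self-injectivity extends the restriction
  -- of `f` from `N` to a functional `g` on `R ^ n`, whose values on the standard basis express that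
  -- restriction through the `d i`.
  obtain ⟨g, hg⟩ := hR.out (LinearMap.range δ).subtype (Submodule.injective_subtype _)
    (res f ∘ₗ e.symm.toLinearMap)
  have hf : res f = ∑ i, g (Pi.single i 1) • d i := by
    ext x
    have h1 := hg (e x)
    simp only [LinearMap.comp_apply, LinearEquiv.coe_coe, LinearEquiv.symm_apply_apply] at h1
    rw [← h1]
    change g (δ x) = _
    rw [LinearMap.pi_apply_eq_sum_univ g (δ x)]
    simp [δ, mul_comm]
    refine Finset.sum_congr rfl fun i _ => ?_
    congr 2
    ext j
    simp [Pi.single_apply, eq_comm]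
  have hmem : res f ∈ D.map res := by
    rw [hf, ← hd]
    exact Submodule.sum_mem _ fun i _ => Submodule.smul_mem _ _ (Submodule.subset_span ⟨i, rfl⟩)
  obtain ⟨g', hg', he⟩ := hmem
  exact ⟨g', hg', fun x hx => LinearMap.congr_fun he ⟨x, Submodule.subset_span hx⟩⟩

lemma IsFinitelyDense.trans {M : Type v} {N : Type w} [AddCommGroup M] [Module R M]
    [AddCommGroup N] [Module R N] {K S T : Set (M →ₗ[R] N)} (h₁ : IsFinitelyDense K S)
    (h₂ : IsFinitelyDense S T) : IsFinitelyDense K T := by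
  intro f hf F
  obtain ⟨g, hg, hgf⟩ := h₂ f hf F
  obtain ⟨k, hk, hkg⟩ := h₁ g hg F
  exact ⟨k, hk, fun x hx => (hkg x hx).trans (hgf x hx)⟩

/-- If `U` is dense in the dual of a projective module `W`, then the image of `M ⊗ U` is dense in
`Hom(W, M)`. -/
lemma isFinitelyDense_range_alphaMap {W : Type v} [AddCommGroup W] [Module R W]
    [Module.Projective R W] (U : Submodule R (W →ₗ[R] R))
    (hU : IsFinitelyDense (U : Set (W →ₗ[R] R)) Set.univ)
    (M : Type w) [AddCommGroup M] [Module R M] :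
    IsFinitelyDense (Set.range (alphaMap U M)) Set.univ := by
  classical
  intro φ _ F
  -- The coordinates of the splitting `s` form a dual basis `x = ∑ s x b • b`. Only the `b` in the
  -- finite set `I` matter on `F`, and each coordinate functional is replaced by an element of `U`
  -- that agrees with it on `F`.
  obtain ⟨s, hs⟩ := Module.projective_def.mp ‹Module.Projective R W›
  let I : Finset W := F.biUnion fun x => (s x).support
  choose f hfU hf using fun b : W => hU (Finsupp.lapply b ∘ₗ s) trivial F
  refine ⟨_, ⟨∑ b ∈ I, φ b ⊗ₜ ⟨f b, hfU b⟩, rfl⟩, fun x hx => ?_⟩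
  have hx' : x = ∑ b ∈ I, s x b • b := by
    conv_lhs => rw [← hs x, Finsupp.linearCombination_apply]
    exact Finsupp.sum_of_support_subset _ (Finset.subset_biUnion_of_mem (fun x => (s x).support) hx)
      _ (by simp)
  conv_rhs => rw [hx', map_sum]
  rw [map_sum, LinearMap.sum_apply]
  refine Finset.sum_congr rfl fun b _ => ?_
  rw [alphaMap_tmul, map_smul]
  simp [hf b x hx]

end Density

/-! ### The action of `B # U` on `B` -/

section SmashAction

variable {R : Type u} [CommRing R] {H : Type v} [Ring H] [Bialgebra R H]
  {B : Type w} [Ring B] [Algebra R B] [RightComoduleAlgebra R H B]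

variable (B) in
/-- The left action of `H*` on a right `H`-comodule algebra, `f ⇀ b = ∑ b₀ f(b₁)`. -/
def coactHit (f : H →ₗ[R] R) : B →ₗ[R] B :=
  (TensorProduct.rid R B).toLinearMap ∘ₗ f.lTensor B ∘ₗ RightSmash.rho R H

lemma coactHit_apply (f : H →ₗ[R] R) (b : B) :
    coactHit B f b = TensorProduct.rid R B (f.lTensor B (RightSmash.rho R H b)) := rfl

lemma coactHit_add (f g : H →ₗ[R] R) : coactHit B (f + g) = coactHit B f + coactHit B g := by
  ext; simp [coactHit_apply]

lemma coactHit_smul (r : R) (f : H →ₗ[R] R) : coactHit B (r • f) = r • coactHit B f := by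
  ext; simp [coactHit_apply]

lemma coactHit_counit : coactHit B (Coalgebra.counit : H →ₗ[R] R) = LinearMap.id := by
  ext b
  rw [coactHit_apply]
  exact (congrArg _ (RightComoduleAlgebra.counit (R := R) (H := H) b)).trans (by simp)

/-- Coassociativity of the coaction: both sides are `∑ b₀ f(b₁) g(b₂)`. -/
lemma coactHit_coactHit (f g : H →ₗ[R] R) (b : B) :
    coactHit B f (coactHit B g b) = coactHit B (conv f g) b := by
  have hco : TensorProduct.assoc R B H H
      ((RightSmash.rho R H).rTensor H (RightSmash.rho R H b)) =
      (Coalgebra.comul (R := R) (A := H)).lTensor B (RightSmash.rho R H b) :=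
    RightComoduleAlgebra.coassoc (R := R) (H := H) b
  let Φ : B ⊗[R] (H ⊗[R] H) →ₗ[R] B := (TensorProduct.rid R B).toLinearMap ∘ₗ
    (LinearMap.mul' R R ∘ₗ TensorProduct.map f g).lTensor B
  have h1 : ∀ t : B ⊗[R] H, coactHit B f (TensorProduct.rid R B (g.lTensor B t)) =
      Φ (TensorProduct.assoc R B H H ((RightSmash.rho R H).rTensor H t)) := by
    intro t
    induction t with
    | zero => simp
    | add x y hx hy => simp only [map_add, hx, hy]
    | tmul x h =>
      simp only [LinearMap.lTensor_tmul, TensorProduct.rid_tmul, map_smul, coactHit_apply,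
        LinearMap.rTensor_tmul]
      generalize RightSmash.rho R H x = s
      induction s with
      | zero => simp
      | add x y hx hy => simp only [map_add, hx, hy, smul_add, TensorProduct.add_tmul]
      | tmul y k => simp [Φ, smul_smul, mul_comm]
  rw [coactHit_apply g, h1, hco, coactHit_apply]
  generalize RightSmash.rho R H b = t
  induction t with
  | zero => simp
  | add x y hx hy => simp only [map_add, hx, hy]
  | tmul x h =>
    simp only [Φ, LinearMap.comp_apply, LinearMap.lTensor_tmul, LinearEquiv.coe_coe]
    congr 2

/-- The coaction is multiplicative, so `f(b₁ c₁) = (f b₁)(c₁)`. This is the commutation rule behind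
the product of `B # U`. -/
lemma coactHit_mul (f : H →ₗ[R] R) (b c : B) (S : Finset (B × H))
    (hS : RightSmash.rho R H b = ∑ p ∈ S, p.1 ⊗ₜ p.2) :
    coactHit B f (b * c) = ∑ p ∈ S, p.1 * coactHit B (rightAct f p.2) c := by
  have hmul : RightSmash.rho R H (b * c) = RightSmash.rho R H b * RightSmash.rho R H c :=
    map_mul (RightComoduleAlgebra.coact (R := R) (H := H) (B := B)) b c
  rw [coactHit_apply, hmul, hS, Finset.sum_mul, map_sum, map_sum]
  refine Finset.sum_congr rfl fun p _ => ?_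
  rw [coactHit_apply]
  generalize RightSmash.rho R H c = t
  induction t with
  | zero => simp
  | add x y hx hy => simp only [map_add, mul_add, hx, hy]
  | tmul x h => simp

variable (R H B) (U : Submodule R (H →ₗ[R] R))

/-- The map `b ⊗ f ↦ [c ↦ b (f ⇀ c)]`. -/
def smashActMap : B ⊗[R] U →ₗ[R] Module.End R B :=
  TensorProduct.lift (LinearMap.mk₂ R (fun b f => LinearMap.mulLeft R b ∘ₗ coactHit B f.1)
    (by intros; ext; simp [add_mul]) (by intros; ext; simp)
    (by intros; ext; simp [coactHit_add, mul_add]) (by intros; ext; simp [coactHit_smul]))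

variable {R H B U}

lemma smashActMap_tmul (b : B) (f : U) (c : B) :
    smashActMap R H B U (b ⊗ₜ f) c = b * coactHit B f.1 c := by
  simp [smashActMap]

variable [hU : IsRightModuleSubalgebra U]

lemma smashActMap_mulMap (x y : B ⊗[R] U) :
    smashActMap R H B U (RightSmash.mulMap R H U B x y) =
      smashActMap R H B U x * smashActMap R H B U y := by
  induction x with
  | zero => simp
  | add x x' hx hx' => simp only [map_add, LinearMap.add_apply, hx, hx', add_mul]
  | tmul b f =>
  induction y with
  | zero => simp
  | add y y' hy hy' => simp only [map_add, hy, hy', mul_add]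
  | tmul c g =>
  ext d
  obtain ⟨S, hS⟩ := TensorProduct.exists_finset (RightSmash.rho R H c)
  rw [RightSmash.mulMap_tmul, Module.End.mul_apply, smashActMap_tmul, smashActMap_tmul,
    coactHit_mul _ _ _ S hS, hS, Finset.mul_sum, map_sum, map_sum, LinearMap.sum_apply]
  refine Finset.sum_congr rfl fun p _ => ?_
  rw [TensorProduct.map_tmul, smashActMap_tmul, RightSmash.coe_actConv, coactHit_coactHit,
    LinearMap.mulLeft_apply, mul_assoc]

variable (R H B U)

/-- The action of `B # U` on `B`, `(b # f) c = b (f ⇀ c)`. -/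
def smashAct : RightSmash R H B U →ₐ[R] Module.End R B :=
  AlgHom.ofLinearMap (smashActMap R H B U ∘ₗ (RightSmash.mk R H U B).symm.toLinearMap)
    (by
      ext c
      change smashActMap R H B U (1 ⊗ₜ ⟨Coalgebra.counit, hU.counit_mem⟩) c = c
      simp [smashActMap_tmul, coactHit_counit])
    smashActMap_mulMap

variable {R H B U}

lemma smashAct_mk (t : B ⊗[R] U) :
    smashAct R H B U (RightSmash.mk R H U B t) = smashActMap R H B U t := rfl

end SmashAction

/-! ### The regular coaction of `H` -/

section Regular

variable {R : Type u} [CommRing R] {H : Type v} [Ring H] [Bialgebra R H]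

/-- A bialgebra is a right comodule algebra over itself. -/
instance : RightComoduleAlgebra R H H where
  coact := Bialgebra.comulAlgHom R H
  coassoc := Coalgebra.coassoc_apply
  counit := Coalgebra.lTensor_counit_comul

lemma coactHit_self (f : H →ₗ[R] R) : coactHit H f = leftHit f := rfl

lemma leftHit_repr {ι : Type*} (f : H →ₗ[R] R) (k : H) (r : Coalgebra.Repr R k ι) :
    leftHit f k = ∑ i ∈ r.index, f (r.right i) • r.left i := by
  simp [leftHit, ← r.eq]

lemma rightHit_repr {ι : Type*} (f : H →ₗ[R] R) (k : H) (r : Coalgebra.Repr R k ι) :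
    rightHit f k = ∑ i ∈ r.index, f (r.left i) • r.right i := by
  simp [rightHit, ← r.eq]

end Regular

/-! ### The action of `H*` on `A # H` -/

section LeftSmashAction

variable {R : Type u} [CommRing R] {H : Type v} [Ring H] [Bialgebra R H]
  {A : Type w} [Ring A] [Algebra R A] [Module H A] [IsModuleAlgebra R H A]

lemma coactHit_leftSmash_tmul (f : H →ₗ[R] R) (a : A) (h : H) :
    coactHit (LeftSmash R H A) f (LeftSmash.tmul a h) = LeftSmash.tmul a (leftHit f h) := by
  rw [coactHit_apply]
  change TensorProduct.rid R _ (f.lTensor _ (LeftSmash.coactMap R H A _)) = _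
  rw [LeftSmash.coactMap_tmul a h (Coalgebra.Repr.arbitrary R h),
    leftHit_repr f h (Coalgebra.Repr.arbitrary R h)]
  simp [LeftSmash.tmul, TensorProduct.tmul_sum]

end LeftSmashAction

open Coalgebra

/-! ### Twisted antipode identities and density of the image of `H # U` -/

section TwistedAntipode

variable {R : Type u} [CommRing R] {H : Type v} [Ring H] [Bialgebra R H] {T : H →ₗ[R] H}

/-- The identity `∑ k₂ T(k₁) ⊗ k₃ = 1 ⊗ k`: coassociativity moves the second splitting to the left
leg, where the antipode axiom collapses it to a counit. This form, with a spare leg, is what inverts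
the twists below. -/
lemma IsTwistedAntipode.sum_right (hT : IsTwistedAntipode T) {ι : Type*} {κ : ι → Type*} {k : H}
    (r : Repr R k ι) (s : ∀ i, Repr R (r.right i) (κ i)) :
    ∑ i ∈ r.index, ∑ j ∈ (s i).index,
      ((s i).left j * T (r.left i)) ⊗ₜ[R] (s i).right j = 1 ⊗ₜ k := by
  let Λ : H ⊗[R] (H ⊗[R] H) →ₗ[R] H ⊗[R] H :=
    (LinearMap.mul' R H ∘ₗ TensorProduct.map LinearMap.id T ∘ₗ
      (TensorProduct.comm R H H).toLinearMap).rTensor H ∘ₗ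
    (TensorProduct.assoc R H H H).symm.toLinearMap
  have h1 := congrArg Λ (sum_tmul_tmul_eq r (fun i => ℛ R (r.left i)) s)
  have h2 : ∀ i ∈ r.index, ∑ j ∈ (ℛ R (r.left i)).index,
      ((ℛ R (r.left i)).right j * T ((ℛ R (r.left i)).left j)) ⊗ₜ[R] r.right i =
      1 ⊗ₜ (counit (R := R) (r.left i) • r.right i) := by
    intro i _
    have := LinearMap.congr_fun hT.right (r.left i)
    simp only [LinearMap.comp_apply, LinearEquiv.coe_coe, Algebra.linearMap_apply] at this
    rw [← (ℛ R (r.left i)).eq] at this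
    simp only [map_sum, TensorProduct.comm_tmul, TensorProduct.map_tmul, LinearMap.id_apply,
      LinearMap.mul'_apply] at this
    rw [← TensorProduct.sum_tmul, this, Algebra.algebraMap_eq_smul_one, TensorProduct.smul_tmul]
  simp only [Λ, map_sum, LinearMap.comp_apply, LinearEquiv.coe_coe,
    TensorProduct.assoc_symm_tmul, LinearMap.rTensor_tmul, TensorProduct.comm_tmul,
    TensorProduct.map_tmul, LinearMap.id_apply, LinearMap.mul'_apply] at h1
  rw [← h1, Finset.sum_congr rfl h2, ← TensorProduct.tmul_sum]
  congr 1
  exact sum_counit_smul r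

lemma IsTwistedAntipode.sum_left (hT : IsTwistedAntipode T) {ι : Type*} {κ : ι → Type*} {k : H}
    (r : Repr R k ι) (s : ∀ i, Repr R (r.right i) (κ i)) :
    ∑ i ∈ r.index, ∑ j ∈ (s i).index,
      (T ((s i).left j) * r.left i) ⊗ₜ[R] (s i).right j = 1 ⊗ₜ k := by
  let Λ : H ⊗[R] (H ⊗[R] H) →ₗ[R] H ⊗[R] H :=
    (LinearMap.mul' R H ∘ₗ TensorProduct.map T LinearMap.id ∘ₗ
      (TensorProduct.comm R H H).toLinearMap).rTensor H ∘ₗ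
    (TensorProduct.assoc R H H H).symm.toLinearMap
  have h1 := congrArg Λ (sum_tmul_tmul_eq r (fun i => ℛ R (r.left i)) s)
  have h2 : ∀ i ∈ r.index, ∑ j ∈ (ℛ R (r.left i)).index,
      (T ((ℛ R (r.left i)).right j) * ((ℛ R (r.left i)).left j)) ⊗ₜ[R] r.right i =
      1 ⊗ₜ (counit (R := R) (r.left i) • r.right i) := by
    intro i _
    have := LinearMap.congr_fun hT.left (r.left i)
    simp only [LinearMap.comp_apply, LinearEquiv.coe_coe, Algebra.linearMap_apply] at this
    rw [← (ℛ R (r.left i)).eq] at this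
    simp only [map_sum, TensorProduct.comm_tmul, TensorProduct.map_tmul, LinearMap.id_apply,
      LinearMap.mul'_apply] at this
    rw [← TensorProduct.sum_tmul, this, Algebra.algebraMap_eq_smul_one, TensorProduct.smul_tmul]
  simp only [Λ, map_sum, LinearMap.comp_apply, LinearEquiv.coe_coe,
    TensorProduct.assoc_symm_tmul, LinearMap.rTensor_tmul, TensorProduct.comm_tmul,
    TensorProduct.map_tmul, LinearMap.id_apply, LinearMap.mul'_apply] at h1
  rw [← h1, Finset.sum_congr rfl h2, ← TensorProduct.tmul_sum]
  congr 1
  exact sum_counit_smul r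

section RightModule

variable {M : Type w} [AddCommGroup M] [Module R M] (μ : M →ₗ[R] H →ₗ[R] M)

/-- For a bilinear right action `μ` of `H` on `M` and `S : H → H`, the endomorphism
`φ ↦ [k ↦ ∑ φ(k₂) S(k₁)]` of `Hom(H, M)`. -/
def hitTwist (S : H →ₗ[R] H) (φ : H →ₗ[R] M) : H →ₗ[R] M :=
  TensorProduct.lift μ ∘ₗ TensorProduct.map φ S ∘ₗ (TensorProduct.comm R H H).toLinearMap ∘ₗ comul

variable {μ}

lemma hitTwist_repr (S : H →ₗ[R] H) (φ : H →ₗ[R] M) {ι : Type*} {k : H} (r : Repr R k ι) :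
    hitTwist μ S φ k = ∑ i ∈ r.index, μ (φ (r.right i)) (S (r.left i)) := by
  simp [hitTwist, ← r.eq]

/-- The composite is `k ↦ ∑ φ(k₃) k₂ T(k₁)`, which `sum_right` reduces to `φ(k)`. -/
lemma hitTwist_twistedAntipode_hitTwist_id (hμ₁ : ∀ m, μ m 1 = m)
    (hμ : ∀ m h k, μ (μ m h) k = μ m (h * k)) (hT : IsTwistedAntipode T) (φ : H →ₗ[R] M) :
    hitTwist μ T (hitTwist μ LinearMap.id φ) = φ := by
  ext k
  rw [hitTwist_repr T _ (ℛ R k)]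
  have := congrArg (TensorProduct.lift (μ.flip.compl₂ φ))
    (hT.sum_right (ℛ R k) (fun i => ℛ R ((ℛ R k).right i)))
  simp only [map_sum, TensorProduct.lift.tmul, LinearMap.compl₂_apply, LinearMap.flip_apply,
    hμ₁] at this
  rw [← this]
  refine Finset.sum_congr rfl fun i _ => ?_
  rw [hitTwist_repr _ _ (ℛ R ((ℛ R k).right i)), map_sum, LinearMap.sum_apply]
  simp [hμ]

lemma hitTwist_id_hitTwist_twistedAntipode (hμ₁ : ∀ m, μ m 1 = m)
    (hμ : ∀ m h k, μ (μ m h) k = μ m (h * k)) (hT : IsTwistedAntipode T) (φ : H →ₗ[R] M) :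
    hitTwist μ LinearMap.id (hitTwist μ T φ) = φ := by
  ext k
  rw [hitTwist_repr _ _ (ℛ R k)]
  have := congrArg (TensorProduct.lift (μ.flip.compl₂ φ))
    (hT.sum_left (ℛ R k) (fun i => ℛ R ((ℛ R k).right i)))
  simp only [map_sum, TensorProduct.lift.tmul, LinearMap.compl₂_apply, LinearMap.flip_apply,
    hμ₁] at this
  rw [← this]
  refine Finset.sum_congr rfl fun i _ => ?_
  rw [hitTwist_repr _ _ (ℛ R ((ℛ R k).right i)), map_sum, LinearMap.sum_apply]
  simp [hμ]

end RightModule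

/-- Writing `h k₁ f(k₂)` as `(f(k₂) h) k₁` separates the action of `H # U` into the canonical map
and an invertible twist; density can then be tested on the canonical map. -/
lemma smashActMap_self (U : Submodule R (H →ₗ[R] R)) (t : H ⊗[R] U) :
    smashActMap R H H U t = hitTwist (LinearMap.mul R H) LinearMap.id (alphaMap U H t) := by
  induction t with
  | zero => ext; simp [hitTwist]
  | add x y hx hy =>
    rw [map_add, hx, hy, map_add]
    ext k
    simp [hitTwist_repr _ _ (ℛ R k), Finset.sum_add_distrib]
  | tmul h f =>
    ext k
    rw [smashActMap_tmul, coactHit_self, leftHit_repr _ _ (ℛ R k), hitTwist_repr _ _ (ℛ R k)]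
    simp [alphaMap_tmul, Finset.mul_sum]

/-- If `U` is dense in `H*` then the image of `H # U` in `End(H)` is dense. -/
lemma isFinitelyDense_range_smashAct [Module.Projective R H] (hT : IsTwistedAntipode T)
    (U : Submodule R (H →ₗ[R] R)) [IsRightModuleSubalgebra U]
    (hU : IsFinitelyDense (U : Set (H →ₗ[R] R)) Set.univ) :
    IsFinitelyDense ((smashAct R H H U).range : Set (H →ₗ[R] H)) Set.univ := by
  classical
  intro φ _ F
  -- The map to approximate is `φ` with the twist undone. Twisting back at `k` uses its values only
  -- at the right legs `k₂` of a chosen expression of `Δ(k)`, so agreement on these finitely many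
  -- elements is enough.
  obtain ⟨_, ⟨t, rfl⟩, ht⟩ := isFinitelyDense_range_alphaMap U hU H
    (hitTwist (LinearMap.mul R H) T φ) trivial
    (F.biUnion fun k => (ℛ R k).index.image (ℛ R k).right)
  refine ⟨smashActMap R H H U t, ⟨RightSmash.mk R H U H t, rfl⟩, fun k hk => ?_⟩
  rw [smashActMap_self, hitTwist_repr _ _ (ℛ R k)]
  conv_rhs => rw [← hitTwist_id_hitTwist_twistedAntipode (μ := LinearMap.mul R H) (by simp)
    (by simp [mul_assoc]) hT φ, hitTwist_repr _ _ (ℛ R k)]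
  refine Finset.sum_congr rfl fun i hi => ?_
  rw [ht _ (Finset.mem_biUnion.mpr ⟨k, hk, Finset.mem_image_of_mem _ hi⟩)]

end TwistedAntipode

/-! ### The isomorphism `θ : A ⊗ H ≃ A # H` -/

section Twist

variable {R : Type u} [CommRing R] {H : Type v} [Ring H] [Bialgebra R H] {T : H →ₗ[R] H}
  {A : Type w} [Ring A] [Algebra R A] [Module H A] [IsModuleAlgebra R H A]

lemma actOn_add (b c : A) :
    LeftSmash.actOn (H := H) R (b + c) = LeftSmash.actOn R b + LeftSmash.actOn R c := by
  ext; simp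

lemma actOn_smul (r : R) (b : A) :
    LeftSmash.actOn (H := H) R (r • b) = r • LeftSmash.actOn R b := by
  ext x; simpa using smul_algebra_smul_comm r x b

variable (A) in
/-- The map `b ⊗ k ↦ ∑ S(k₁) b ⊗ k₂`. -/
def twistBy (S : H →ₗ[R] H) : A ⊗[R] H →ₗ[R] A ⊗[R] H :=
  TensorProduct.lift (LinearMap.mk₂ R
    (fun b k => (LeftSmash.actOn R b ∘ₗ S).rTensor H (comul (R := R) k))
    (by intros; simp [actOn_add, LinearMap.add_comp])
    (by intros; simp [actOn_smul, LinearMap.smul_comp])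
    (by intros; simp) (by intros; simp))

lemma twistBy_repr (S : H →ₗ[R] H) (b : A) {ι : Type*} {k : H} (r : Repr R k ι) :
    twistBy A S (b ⊗ₜ k) = ∑ i ∈ r.index, (S (r.left i) • b) ⊗ₜ r.right i := by
  simp [twistBy, ← r.eq]

lemma twistBy_twistedAntipode (hT : IsTwistedAntipode T) (x : A ⊗[R] H) :
    twistBy A LinearMap.id (twistBy A T x) = x := by
  induction x with
  | zero => simp
  | add x y hx hy => simp only [map_add, hx, hy]
  | tmul b k =>
    rw [twistBy_repr T b (ℛ R k), map_sum]
    have := congrArg ((LeftSmash.actOn R b).rTensor H)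
      (hT.sum_right (ℛ R k) (fun i => ℛ R ((ℛ R k).right i)))
    simp only [map_sum, LinearMap.rTensor_tmul, LeftSmash.actOn_apply, one_smul] at this
    rw [← this]
    refine Finset.sum_congr rfl fun i _ => ?_
    rw [twistBy_repr _ _ (ℛ R ((ℛ R k).right i))]
    simp [mul_smul]

lemma twistedAntipode_twistBy (hT : IsTwistedAntipode T) (x : A ⊗[R] H) :
    twistBy A T (twistBy A LinearMap.id x) = x := by
  induction x with
  | zero => simp
  | add x y hx hy => simp only [map_add, hx, hy]
  | tmul b k =>
    rw [twistBy_repr _ b (ℛ R k), map_sum]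
    have := congrArg ((LeftSmash.actOn R b).rTensor H)
      (hT.sum_left (ℛ R k) (fun i => ℛ R ((ℛ R k).right i)))
    simp only [map_sum, LinearMap.rTensor_tmul, LeftSmash.actOn_apply, one_smul] at this
    rw [← this]
    refine Finset.sum_congr rfl fun i _ => ?_
    rw [twistBy_repr _ _ (ℛ R ((ℛ R k).right i))]
    simp [mul_smul]

variable (A) in
/-- The isomorphism `A ⊗ H ≃ A # H`, `b ⊗ k ↦ ∑ k₁ b # k₂ = (1 # k) (b # 1)`. -/
def twistEquiv (hT : IsTwistedAntipode T) : A ⊗[R] H ≃ₗ[R] LeftSmash R H A :=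
  LinearEquiv.ofLinearMap (twistBy A LinearMap.id) (twistBy A T)
    (LinearMap.ext (twistBy_twistedAntipode hT)) (LinearMap.ext (twistedAntipode_twistBy hT)) ≪≫ₗ
  LeftSmash.mk R H A

lemma twistEquiv_apply (hT : IsTwistedAntipode T) (x : A ⊗[R] H) :
    twistEquiv A hT x = LeftSmash.mk R H A (twistBy A LinearMap.id x) := rfl

lemma twistEquiv_repr (hT : IsTwistedAntipode T) (b : A) {ι : Type*} {k : H} (r : Repr R k ι) :
    twistEquiv A hT (b ⊗ₜ k) = ∑ i ∈ r.index, LeftSmash.tmul (r.left i • b) (r.right i) := by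
  rw [twistEquiv_apply, twistBy_repr _ _ r, map_sum]
  rfl

lemma mul_mk (a : A) (x : A ⊗[R] H) :
    LeftSmash.tmul a 1 * LeftSmash.mk R H A x =
      LeftSmash.mk R H A ((LinearMap.mulLeft R a).rTensor H x) := by
  induction x with
  | zero => simp
  | add x y hx hy => simp only [map_add, mul_add, hx, hy]
  | tmul b k =>
    change LeftSmash.mulMap R H A (a ⊗ₜ 1) (b ⊗ₜ k) = _
    rw [LeftSmash.mulMap_tmul, Bialgebra.comul_one, Algebra.TensorProduct.one_def]
    simp
    rfl

/-- Since `θ(b ⊗ k) = (1 # k)(b # 1)`, left multiplication by `1 # h` only changes `k`; in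
coordinates this is multiplicativity of `Δ`. -/
lemma one_tmul_mul_twistEquiv (hT : IsTwistedAntipode T) (h : H) (b : A) (k : H) :
    LeftSmash.tmul 1 h * twistEquiv A hT (b ⊗ₜ k) = twistEquiv A hT (b ⊗ₜ (h * k)) := by
  have hc : comul (R := R) (h * k) = ∑ i ∈ (ℛ R k).index, ∑ j ∈ (ℛ R h).index,
      ((ℛ R h).left j * (ℛ R k).left i) ⊗ₜ[R] ((ℛ R h).right j * (ℛ R k).right i) := by
    rw [Bialgebra.comul_mul, ← (ℛ R h).eq, ← (ℛ R k).eq, Finset.sum_mul_sum, Finset.sum_comm]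
    simp
  rw [twistEquiv_repr hT b (ℛ R k), Finset.mul_sum]
  have : twistEquiv A hT (b ⊗ₜ (h * k)) =
      LeftSmash.mk R H A ((LeftSmash.actOn R b).rTensor H (comul (R := R) (h * k))) := by
    simp [twistEquiv_apply, twistBy]
  rw [this, hc, map_sum, map_sum]
  refine Finset.sum_congr rfl fun i _ => ?_
  rw [LeftSmash.tmul_mul_tmul _ _ (ℛ R h), map_sum, map_sum]
  refine Finset.sum_congr rfl fun j _ => ?_
  simp [LeftSmash.tmul, mul_smul]

/-- By coassociativity both sides are `∑ k₁ b # k₂ f(k₃)`: the hit touches only the last leg, the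
twist only the first. -/
lemma coactHit_twistEquiv (hT : IsTwistedAntipode T) (f : H →ₗ[R] R) (b : A) (k : H) :
    coactHit (LeftSmash R H A) f (twistEquiv A hT (b ⊗ₜ k)) =
      twistEquiv A hT (b ⊗ₜ leftHit f k) := by
  let Λ : H ⊗[R] (H ⊗[R] H) →ₗ[R] LeftSmash R H A :=
    (LeftSmash.mk R H A).toLinearMap ∘ₗ TensorProduct.map (LeftSmash.actOn R b)
      ((TensorProduct.rid R H).toLinearMap ∘ₗ f.lTensor H)
  have h1 := congrArg Λ (sum_tmul_tmul_eq (ℛ R k) (fun i => ℛ R ((ℛ R k).left i))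
    (fun i => ℛ R ((ℛ R k).right i)))
  simp only [Λ, map_sum, LinearMap.comp_apply, LinearEquiv.coe_coe, LinearMap.lTensor_tmul,
    TensorProduct.map_tmul, TensorProduct.rid_tmul, LeftSmash.actOn_apply] at h1
  rw [twistEquiv_repr hT b (ℛ R k), map_sum, leftHit_repr f k (ℛ R k), TensorProduct.tmul_sum,
    map_sum]
  refine Eq.trans ?_ (h1.symm.trans ?_)
  · refine Finset.sum_congr rfl fun i _ => ?_
    rw [coactHit_leftSmash_tmul, leftHit_repr f _ (ℛ R ((ℛ R k).right i))]
    simp [LeftSmash.tmul, TensorProduct.tmul_sum]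
  · refine Finset.sum_congr rfl fun i _ => ?_
    rw [TensorProduct.tmul_smul, map_smul, twistEquiv_repr hT b (ℛ R ((ℛ R k).left i)),
      Finset.smul_sum]
    simp [LeftSmash.tmul]

/-- `k (x b) = ∑ (k₁ x) (k₂ b)`, with a further tensor factor `k₃`. -/
lemma twistBy_mul_tmul (x b : A) {ι : Type*} {k : H} (r : Repr R k ι) :
    twistBy A LinearMap.id ((x * b) ⊗ₜ k) = ∑ i ∈ r.index,
      (LinearMap.mulLeft R (r.left i • x)).rTensor H (twistBy A LinearMap.id (b ⊗ₜ r.right i)) := by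
  let Λ : H ⊗[R] (H ⊗[R] H) →ₗ[R] A ⊗[R] H :=
    (LinearMap.mul' R A ∘ₗ TensorProduct.map (LeftSmash.actOn R x)
      (LeftSmash.actOn R b)).rTensor H ∘ₗ (TensorProduct.assoc R H H H).symm.toLinearMap
  have h1 := congrArg Λ (sum_tmul_tmul_eq r (fun i => ℛ R (r.left i))
    (fun i => ℛ R (r.right i)))
  simp only [Λ, map_sum, LinearMap.comp_apply, LinearEquiv.coe_coe, LinearMap.rTensor_tmul,
    TensorProduct.map_tmul, TensorProduct.assoc_symm_tmul, LinearMap.mul'_apply,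
    LeftSmash.actOn_apply] at h1
  rw [twistBy_repr _ _ r]
  refine Eq.trans ?_ (h1.trans ?_)
  · refine Finset.sum_congr rfl fun i _ => ?_
    rw [LinearMap.id_apply, LeftSmash.smul_mul_repr _ (ℛ R (r.left i)), TensorProduct.sum_tmul]
  · refine Finset.sum_congr rfl fun i _ => ?_
    rw [twistBy_repr _ _ (ℛ R (r.right i))]
    simp

/-- `∑ k₂ ((T(k₁) a) b) ⊗ k₃ = ∑ a (k₁ b) ⊗ k₂` for a twisted antipode `T`. -/
lemma sum_twistBy_twistedAntipode (hT : IsTwistedAntipode T) (a b : A) {ι : Type*} {k : H}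
    (r : Repr R k ι) :
    ∑ i ∈ r.index, twistBy A LinearMap.id (((T (r.left i) • a) * b) ⊗ₜ r.right i) =
      (LinearMap.mulLeft R a).rTensor H (twistBy A LinearMap.id (b ⊗ₜ k)) := by
  -- `Γ(u ⊗ v) = ∑ (u a)(v₁ b) ⊗ v₂`. Applied to `∑ k₂ T(k₁) ⊗ k₃ = 1 ⊗ k` it gives the claim, once
  -- the action on the product has been expanded.
  let Γ : H ⊗[R] H →ₗ[R] A ⊗[R] H := TensorProduct.lift
    ((LinearMap.rTensorHom H ∘ₗ LinearMap.mul R A ∘ₗ LeftSmash.actOn R a).compl₂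
      (twistBy A LinearMap.id ∘ₗ TensorProduct.mk R A H b))
  have hΓ : ∀ u v, Γ (u ⊗ₜ v) =
      (LinearMap.mulLeft R (u • a)).rTensor H (twistBy A LinearMap.id (b ⊗ₜ v)) :=
    fun _ _ => rfl
  have h1 := congrArg Γ (hT.sum_right r (fun i => ℛ R (r.right i)))
  simp only [map_sum, hΓ, one_smul] at h1
  rw [← h1]
  refine Finset.sum_congr rfl fun i _ => ?_
  rw [twistBy_mul_tmul _ _ (ℛ R (r.right i))]
  simp [mul_smul]

/-- The action of `1 # (h # f)` corresponds to `id ⊗ (h # f)`. -/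
lemma smashActMap_one_tmul_twistEquiv (hT : IsTwistedAntipode T) {U : Submodule R (H →ₗ[R] R)}
    (h : H) (f : U) (x : A ⊗[R] H) :
    smashActMap R H (LeftSmash R H A) U (LeftSmash.tmul 1 h ⊗ₜ f) (twistEquiv A hT x) =
      twistEquiv A hT (TensorProduct.map LinearMap.id (smashActMap R H H U (h ⊗ₜ f)) x) := by
  induction x with
  | zero => simp
  | add x y hx hy => simp only [map_add, hx, hy]
  | tmul b k =>
    rw [smashActMap_tmul, coactHit_twistEquiv, one_tmul_mul_twistEquiv, TensorProduct.map_tmul,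
      smashActMap_tmul, coactHit_self, LinearMap.id_apply]

end Twist

/-! ### Faithfulness of both actions and comparison of their images -/

section Duality

variable {R : Type u} [CommRing R] {H : Type v} [Ring H] [Bialgebra R H] {T : H →ₗ[R] H}
  {A : Type w} [Ring A] [Algebra R A]

variable (R H A) in
/-- The right regular action of `H` on `A ⊗ H`. -/
def tensorRightMul : A ⊗[R] H →ₗ[R] H →ₗ[R] A ⊗[R] H :=
  (LinearMap.lTensorHom A ∘ₗ (LinearMap.mul R H).flip).flip

lemma tensorRightMul_tmul (a : A) (h k : H) :
    tensorRightMul R H A (a ⊗ₜ h) k = a ⊗ₜ (h * k) := by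
  simp [tensorRightMul]

lemma tensorRightMul_one (x : A ⊗[R] H) : tensorRightMul R H A x 1 = x := by
  induction x with
  | zero => simp
  | add x y hx hy => simp only [map_add, LinearMap.add_apply, hx, hy]
  | tmul a h => simp [tensorRightMul_tmul]

lemma tensorRightMul_mul (x : A ⊗[R] H) (h k : H) :
    tensorRightMul R H A (tensorRightMul R H A x h) k = tensorRightMul R H A x (h * k) := by
  induction x with
  | zero => simp
  | add x y hx hy => simp only [map_add, LinearMap.add_apply, hx, hy]
  | tmul a h => simp [tensorRightMul_tmul, mul_assoc]

variable (U : Submodule R (H →ₗ[R] R))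

variable (A) in
/-- The map `(a ⊗ h) ⊗ f ↦ [k ↦ ∑ a ⊗ h k₁ f(k₂)]`. -/
def tensorHit (t : (A ⊗[R] H) ⊗[R] U) : H →ₗ[R] A ⊗[R] H :=
  hitTwist (tensorRightMul R H A) LinearMap.id (alphaMap U (A ⊗[R] H) t)

variable {U}

/-- The twist has a left inverse built from `T`, so injectivity of the canonical map is preserved.
-/
lemma tensorHit_injective (hT : IsTwistedAntipode T)
    (hU : Function.Injective (alphaMap U (A ⊗[R] H))) : Function.Injective (tensorHit A U) :=
  (Function.LeftInverse.injective (hitTwist_twistedAntipode_hitTwist_id tensorRightMul_one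
    tensorRightMul_mul hT)).comp hU

lemma tensorHit_add (s t : (A ⊗[R] H) ⊗[R] U) :
    tensorHit A U (s + t) = tensorHit A U s + tensorHit A U t := by
  ext k
  simp [tensorHit, hitTwist_repr _ _ (ℛ R k), Finset.sum_add_distrib]

lemma tensorHit_zero : tensorHit A U 0 = 0 := by
  ext k
  simp [tensorHit, hitTwist_repr _ _ (ℛ R k)]

lemma tensorHit_tmul (a : A) (h : H) (f : U) (k : H) :
    tensorHit A U ((a ⊗ₜ h) ⊗ₜ f) k = a ⊗ₜ (h * leftHit f.1 k) := by
  rw [tensorHit, hitTwist_repr _ _ (ℛ R k), leftHit_repr _ _ (ℛ R k)]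
  simp [alphaMap_tmul, tensorRightMul_tmul, Finset.mul_sum, TensorProduct.tmul_sum]

section Faithful

variable [Module H A] [IsModuleAlgebra R H A]

lemma tmul_mul_one_tmul (a : A) (h k : H) :
    (LeftSmash.tmul a h * LeftSmash.tmul 1 k : LeftSmash R H A) = LeftSmash.tmul a (h * k) := by
  rw [LeftSmash.tmul_mul_tmul _ _ (ℛ R h)]
  conv_rhs => rw [← sum_counit_smul (ℛ R h)]
  simp only [IsModuleAlgebra.smul_one (R := R), LeftSmash.tmul, Finset.sum_mul,
    TensorProduct.tmul_sum, map_sum, ← Algebra.commutes, ← Algebra.smul_def, smul_mul_assoc,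
    TensorProduct.tmul_smul, TensorProduct.smul_tmul']

lemma smashActMap_one_tmul (t : (A ⊗[R] H) ⊗[R] U) (k : H) :
    smashActMap R H (LeftSmash R H A) U ((LeftSmash.mk R H A).toLinearMap.rTensor U t)
      (LeftSmash.tmul 1 k) = LeftSmash.mk R H A (tensorHit A U t k) := by
  induction t with
  | zero => simp [tensorHit_zero]
  | add s t hs ht => simp only [map_add, LinearMap.add_apply, tensorHit_add, hs, ht]
  | tmul x f =>
  induction x with
  | zero => simp [tensorHit_zero]
  | add x y hx hy =>
    simp only [TensorProduct.add_tmul, map_add, LinearMap.add_apply, tensorHit_add, hx, hy]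
  | tmul a h =>
    rw [tensorHit_tmul, LinearMap.rTensor_tmul, smashActMap_tmul, coactHit_leftSmash_tmul]
    exact tmul_mul_one_tmul a h _

/-- The values at the elements `1 # k` already determine the acting element, because they recover
`tensorHit`. -/
lemma smashAct_leftSmash_injective [IsRightModuleSubalgebra U] (hT : IsTwistedAntipode T)
    (hU : Function.Injective (alphaMap U (A ⊗[R] H))) :
    Function.Injective (smashAct R H (LeftSmash R H A) U) := by
  rw [injective_iff_map_eq_zero]
  intro x hx
  obtain ⟨y, rfl⟩ := (RightSmash.mk R H U (LeftSmash R H A)).surjective x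
  obtain ⟨t, rfl⟩ := LinearMap.rTensor_surjective U (g := (LeftSmash.mk R H A).toLinearMap)
    (LeftSmash.mk R H A).surjective y
  have : t = 0 := by
    refine tensorHit_injective hT hU ?_
    rw [tensorHit_zero]
    ext k
    refine (LeftSmash.mk R H A).injective ?_
    rw [← smashActMap_one_tmul, ← smashAct_mk, hx]
    simp
  simp [this]

end Faithful

variable (U) [IsRightModuleSubalgebra U]

variable (A) in
/-- The action of `A ⊗ L` on `A ⊗ H`, where `L` is the image of `H # U` in `End(H)`. -/
def tensorAct : A ⊗[R] (smashAct R H H U).range →ₐ[R] Module.End R (A ⊗[R] H) :=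
  (Module.endTensorEndAlgHom (R := R) (S := R) (A := R) (M := A) (N := H)).comp
    (Algebra.TensorProduct.map (Algebra.lmul R A) (smashAct R H H U).range.val)

variable {U}

lemma tensorAct_tmul (a : A) (l : (smashAct R H H U).range) :
    tensorAct A U (a ⊗ₜ l) = TensorProduct.map (LinearMap.mulLeft R a) l.1 := rfl

/-- An element of `A ⊗ L` is lifted along the surjection from `A ⊗ (H ⊗ U)`. The values at `1 ⊗ k`
are `tensorHit` of the lift, so if the action vanishes then the lift itself is zero. No flatness of
`A` enters. -/
lemma tensorAct_injective (hT : IsTwistedAntipode T)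
    (hU : Function.Injective (alphaMap U (A ⊗[R] H))) : Function.Injective (tensorAct A U) := by
  rw [injective_iff_map_eq_zero]
  intro y hy
  let q : H ⊗[R] U →ₗ[R] (smashAct R H H U).range :=
    (smashAct R H H U).rangeRestrict.toLinearMap ∘ₗ (RightSmash.mk R H U H).toLinearMap
  have hq : Function.Surjective q :=
    (smashAct R H H U).rangeRestrict_surjective.comp (RightSmash.mk R H U H).surjective
  obtain ⟨s, rfl⟩ := LinearMap.lTensor_surjective A hq y
  obtain ⟨t, rfl⟩ := (TensorProduct.assoc R A H U).surjective s
  have key : ∀ t k, tensorAct A U (q.lTensor A (TensorProduct.assoc R A H U t)) (1 ⊗ₜ k) =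
      tensorHit A U t k := by
    intro t k
    induction t with
    | zero => simp [tensorHit_zero]
    | add s t hs ht => simp only [map_add, LinearMap.add_apply, tensorHit_add, hs, ht]
    | tmul x f =>
    induction x with
    | zero => simp [tensorHit_zero]
    | add x y hx hy =>
      simp only [TensorProduct.add_tmul, map_add, LinearMap.add_apply, tensorHit_add, hx, hy]
    | tmul a h =>
      rw [tensorHit_tmul, TensorProduct.assoc_tmul, LinearMap.lTensor_tmul, tensorAct_tmul,
        TensorProduct.map_tmul, LinearMap.mulLeft_apply, mul_one]
      congr 1
  have : t = 0 := by
    refine tensorHit_injective hT hU ?_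
    rw [tensorHit_zero]
    ext1 k
    rw [← key, hy]
    simp
  simp [this]

/-- The RL-condition in operator form: `· ↼ g` is the action of `∑ hⱼ # gⱼ`. -/
lemma rightHit_mem_range {V : Submodule R (H →ₗ[R] R)} (hRL : RLCondition V U)
    {g : H →ₗ[R] R} (hg : g ∈ V) : rightHit g ∈ (smashAct R H H U).range := by
  obtain ⟨n, h, f, hf, e⟩ := hRL g hg
  refine ⟨RightSmash.mk R H U H (∑ j, h j ⊗ₜ ⟨f j, hf j⟩), ?_⟩
  ext k
  change smashActMap R H H U (∑ j, h j ⊗ₜ ⟨f j, hf j⟩) k = _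
  rw [e, map_sum, LinearMap.sum_apply]
  exact Finset.sum_congr rfl fun j _ => smashActMap_tmul _ _ _

lemma conjAlgEquiv_apply_apply {M N : Type*} [AddCommGroup M] [Module R M] [AddCommGroup N]
    [Module R N] (e : M ≃ₗ[R] N) (f : Module.End R M) (x : M) :
    e.conjAlgEquiv R f (e x) = e (f x) := by
  simp

section Coefficients

variable {C : Submodule R (H →ₗ[R] R)}

variable (A C) in
/-- The map `a ⊗ c ↦ [b ⊗ k ↦ ∑ a b ⊗ c(S(k₁)) k₂]`. -/
def coeffAct (S : H →ₗ[R] H) : A ⊗[R] C →ₗ[R] Module.End R (A ⊗[R] H) :=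
  TensorProduct.lift (LinearMap.mk₂ R
    (fun a c => TensorProduct.map (LinearMap.mulLeft R a) (rightHit (c.1 ∘ₗ S)))
    (by intros; ext; simp [add_mul, TensorProduct.add_tmul])
    (by intros; ext; simp [TensorProduct.smul_tmul'])
    (by intros; ext; simp [rightHit, LinearMap.add_comp, TensorProduct.tmul_add])
    (by intros; ext; simp [rightHit, LinearMap.smul_comp]))

lemma coeffAct_tmul (S : H →ₗ[R] H) (a : A) (c : C) :
    coeffAct A C S (a ⊗ₜ c) =
      TensorProduct.map (LinearMap.mulLeft R a) (rightHit (c.1 ∘ₗ S)) := rfl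

lemma coeffAct_repr (S : H →ₗ[R] H) (t : A ⊗[R] C) (b : A) {ι : Type*} {k : H}
    (r : Repr R k ι) : coeffAct A C S t (b ⊗ₜ k) =
      ∑ i ∈ r.index, (alphaMap C A t (S (r.left i)) * b) ⊗ₜ r.right i := by
  induction t with
  | zero => simp
  | add s t hs ht =>
    simp only [map_add, LinearMap.add_apply, hs, ht, add_mul, TensorProduct.add_tmul,
      Finset.sum_add_distrib]
  | tmul a c =>
    rw [coeffAct_tmul, TensorProduct.map_tmul, rightHit_repr _ _ r, TensorProduct.tmul_sum]
    simp [alphaMap_tmul, TensorProduct.smul_tmul']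

lemma coeffAct_mem_range (S : H →ₗ[R] H)
    (hC : ∀ c ∈ C, rightHit (c ∘ₗ S) ∈ (smashAct R H H U).range) (t : A ⊗[R] C) :
    coeffAct A C S t ∈ (tensorAct A U).range := by
  induction t with
  | zero => simp
  | add s t hs ht => rw [map_add]; exact add_mem hs ht
  | tmul a c => exact ⟨a ⊗ₜ ⟨_, hC c c.2⟩, rfl⟩

variable [Module H A] [IsModuleAlgebra R H A]

/-- Left multiplication by `a # 1` corresponds to `∑ a₀ ⊗ (k ↦ k ↼ (a₁ ∘ T))`. -/
lemma twistEquiv_coeffAct (hT : IsTwistedAntipode T) {a : A} {t : A ⊗[R] C}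
    (ht : ∀ h : H, alphaMap C A t h = h • a) (x : A ⊗[R] H) :
    twistEquiv A hT (coeffAct A C T t x) = LeftSmash.tmul a 1 * twistEquiv A hT x := by
  induction x with
  | zero => simp
  | add x y hx hy => simp only [map_add, mul_add, hx, hy]
  | tmul b k =>
    -- Because `t` represents `h ↦ h a`, the left side is `θ(∑ (T(k₁) a) b ⊗ k₂)`.
    rw [coeffAct_repr _ _ _ (ℛ R k), twistEquiv_apply, twistEquiv_apply, mul_mk,
      ← sum_twistBy_twistedAntipode hT _ _ (ℛ R k), map_sum]
    simp only [ht]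

/-- The map `a ⊗ c ↦ [y ↦ (a # 1) θ(id ⊗ (· ↼ c)) θ⁻¹(y)]`, for `θ : A ⊗ H ≃ A # H`. -/
def twistedCoeffAct (hT : IsTwistedAntipode T) :
    A ⊗[R] C →ₗ[R] Module.End R (LeftSmash R H A) :=
  TensorProduct.lift (LinearMap.mk₂ R
    (fun a c => LinearMap.mulLeft R (LeftSmash.tmul a 1) *
      (twistEquiv A hT).conjAlgEquiv R (TensorProduct.map LinearMap.id (rightHit c.1)))
    (by intros; ext; simp [LeftSmash.tmul, TensorProduct.add_tmul, add_mul])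
    (by intros; ext; simp [LeftSmash.tmul, ← TensorProduct.smul_tmul'])
    (by
      intro a c d
      have : rightHit (c + d).1 = rightHit c.1 + rightHit d.1 := by ext; simp [rightHit]
      rw [this, TensorProduct.map_add_right, map_add, mul_add])
    (by
      intro r a c
      have : rightHit (r • c).1 = r • rightHit c.1 := by ext; simp [rightHit]
      rw [this, TensorProduct.map_smul_right, map_smul, mul_smul_comm]))

lemma twistedCoeffAct_tmul (hT : IsTwistedAntipode T) (a : A) (c : C) (b : A) {ι : Type*} {k : H}
    (r : Repr R k ι) :
    twistedCoeffAct hT (a ⊗ₜ c) (twistEquiv A hT (b ⊗ₜ k)) = LeftSmash.mk R H A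
      (∑ i ∈ r.index, (LinearMap.mulLeft R (c.1 (r.left i) • a)).rTensor H
        (twistBy A LinearMap.id (b ⊗ₜ r.right i))) := by
  change LeftSmash.tmul a 1 * twistEquiv A hT (TensorProduct.map LinearMap.id (rightHit c.1)
    ((twistEquiv A hT).symm (twistEquiv A hT (b ⊗ₜ k)))) = _
  rw [LinearEquiv.symm_apply_apply, TensorProduct.map_tmul, rightHit_repr _ _ r,
    twistEquiv_apply, mul_mk]
  congr 1
  have : ∀ (s : R) (x : A ⊗[R] H), (LinearMap.mulLeft R (s • a)).rTensor H x =
      s • (LinearMap.mulLeft R a).rTensor H x := by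
    intro s x
    rw [← LinearMap.smul_apply, ← LinearMap.rTensor_smul]
    congr 2
    ext; simp
  simp only [this, TensorProduct.tmul_sum, map_sum, TensorProduct.tmul_smul, map_smul,
    LinearMap.id_apply]

/-- `θ (a ⊗ id) θ⁻¹ = ∑ (a₀ # 1) θ (id ⊗ (· ↼ a₁)) θ⁻¹`, for `θ : A ⊗ H ≃ A # H`. -/
lemma twistedCoeffAct_eq (hT : IsTwistedAntipode T) {a : A} {t : A ⊗[R] C}
    (ht : ∀ h : H, alphaMap C A t h = h • a) :
    twistedCoeffAct hT t = (twistEquiv A hT).conjAlgEquiv R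
      (TensorProduct.map (LinearMap.mulLeft R a) LinearMap.id) := by
  have key : ∀ (t : A ⊗[R] C) (b : A) (k : H),
      twistedCoeffAct hT t (twistEquiv A hT (b ⊗ₜ k)) = LeftSmash.mk R H A
        (∑ i ∈ (ℛ R k).index, (LinearMap.mulLeft R (alphaMap C A t ((ℛ R k).left i))).rTensor H
          (twistBy A LinearMap.id (b ⊗ₜ (ℛ R k).right i))) := by
    intro t b k
    induction t with
    | zero => simp
    | add s t hs ht =>
      rw [map_add, LinearMap.add_apply, hs, ht, ← map_add, ← Finset.sum_add_distrib]
      congr 1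
      refine Finset.sum_congr rfl fun i _ => ?_
      rw [map_add, LinearMap.add_apply, ← LinearMap.add_apply, ← LinearMap.rTensor_add]
      congr 2
      ext; simp [add_mul]
    | tmul a c => simp only [twistedCoeffAct_tmul hT a c b (ℛ R k), alphaMap_tmul]
  ext y
  obtain ⟨x, rfl⟩ := (twistEquiv A hT).surjective y
  rw [conjAlgEquiv_apply_apply]
  induction x with
  | zero => simp
  | add x y hx hy => simp only [map_add, hx, hy]
  | tmul b k =>
    -- Both sides are `∑ (k₁ a)(k₂ b) # k₃`: on the left from `∑ a₁(k₁) a₀ = k₁ a`, on the right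
    -- from the module algebra law applied to `θ(a b ⊗ k)`.
    rw [key, TensorProduct.map_tmul, twistEquiv_apply, LinearMap.id_apply, LinearMap.mulLeft_apply,
      twistBy_mul_tmul _ _ (ℛ R k)]
    simp only [ht]

lemma conj_tensorAct_one_tmul_mem (hT : IsTwistedAntipode T) (l : (smashAct R H H U).range) :
    (twistEquiv A hT).conjAlgEquiv R (tensorAct A U (1 ⊗ₜ l)) ∈
      (smashAct R H (LeftSmash R H A) U).range := by
  obtain ⟨_, ⟨x, rfl⟩⟩ := l
  rw [tensorAct_tmul, LinearMap.mulLeft_one]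
  obtain ⟨s, rfl⟩ := (RightSmash.mk R H U H).surjective x
  change (twistEquiv A hT).conjAlgEquiv R
    (TensorProduct.map LinearMap.id (smashActMap R H H U s)) ∈ _
  induction s with
  | zero => simp
  | add s t hs ht =>
    rw [map_add, TensorProduct.map_add_right, map_add]
    exact add_mem hs ht
  | tmul h f =>
    refine ⟨RightSmash.mk R H U _ (LeftSmash.tmul 1 h ⊗ₜ f), ?_⟩
    ext y
    obtain ⟨x, rfl⟩ := (twistEquiv A hT).surjective y
    refine (smashActMap_one_tmul_twistEquiv hT h f x).trans ?_
    rw [conjAlgEquiv_apply_apply]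

lemma mulLeft_mem_range_smashAct {B : Type w} [Ring B] [Algebra R B] [RightComoduleAlgebra R H B]
    (b : B) : LinearMap.mulLeft R b ∈ (smashAct R H B U).range := by
  refine ⟨RightSmash.mk R H U B
    (b ⊗ₜ ⟨Coalgebra.counit, IsRightModuleSubalgebra.counit_mem⟩), ?_⟩
  ext c
  refine (smashActMap_tmul b _ c).trans ?_
  simp [coactHit_counit]

/-- The image of `(A # H) # U` in `End(A # H)` is the image of `A ⊗ L`, transported along
`A ⊗ H ≃ A # H`. -/
lemma range_smashAct_eq (hT : IsTwistedAntipode T)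
    (hA : ∀ a : A, ∃ t : A ⊗[R] C, ∀ h : H, alphaMap C A t h = h • a)
    (hC : ∀ c ∈ C, rightHit c ∈ (smashAct R H H U).range)
    (hCT : ∀ c ∈ C, rightHit (c ∘ₗ T) ∈ (smashAct R H H U).range) :
    (smashAct R H (LeftSmash R H A) U).range =
      (((twistEquiv A hT).conjAlgEquiv R).toAlgHom.comp (tensorAct A U)).range := by
  apply le_antisymm
  · rintro _ ⟨x, rfl⟩
    obtain ⟨s, rfl⟩ := (RightSmash.mk R H U (LeftSmash R H A)).surjective x
    change smashActMap R H (LeftSmash R H A) U s ∈ _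
    induction s with
    | zero => simp
    | add s t hs ht => rw [map_add]; exact add_mem hs ht
    | tmul x f =>
    induction x using LeftSmash.induction_on with
    | h0 => simp
    | ha x y hx hy => rw [TensorProduct.add_tmul, map_add]; exact add_mem hx hy
    | ht a h =>
      obtain ⟨t, ht⟩ := hA a
      obtain ⟨y, hy⟩ := coeffAct_mem_range T hCT t
      -- From `a # h = (a # 1)(1 # h)`: the factor `y` realizes left multiplication by `a # 1`, the
      -- other factor the action of `(1 # h) # f`.
      refine ⟨y * (1 ⊗ₜ ⟨smashAct R H H U (RightSmash.mk R H U H (h ⊗ₜ f)), _, rfl⟩), ?_⟩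
      ext z
      obtain ⟨x, rfl⟩ := (twistEquiv A hT).surjective z
      change twistEquiv A hT (tensorAct A U (y * _)
        ((twistEquiv A hT).symm (twistEquiv A hT x))) = _
      have hm : (LeftSmash.tmul a h : LeftSmash R H A) =
          LeftSmash.tmul a 1 * LeftSmash.tmul 1 h := by rw [tmul_mul_one_tmul, one_mul]
      have hy' : tensorAct A U y = coeffAct A C T t := hy
      rw [LinearEquiv.symm_apply_apply, map_mul, Module.End.mul_apply, hy',
        twistEquiv_coeffAct hT ht, smashActMap_tmul, hm, mul_assoc, ← smashActMap_tmul,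
        smashActMap_one_tmul_twistEquiv hT, tensorAct_tmul, LinearMap.mulLeft_one]
      rfl
  · rintro _ ⟨y, rfl⟩
    change (twistEquiv A hT).conjAlgEquiv R (tensorAct A U y) ∈ _
    induction y with
    | zero => simp
    | add x y hx hy => rw [map_add, map_add]; exact add_mem hx hy
    | tmul a l =>
      have h1 : a ⊗ₜ[R] l = (a ⊗ₜ 1) * (1 ⊗ₜ l) := by simp
      rw [h1, map_mul, map_mul]
      refine mul_mem ?_ (conj_tensorAct_one_tmul_mem hT l)
      obtain ⟨t, ht⟩ := hA a
      have h2 : (twistEquiv A hT).conjAlgEquiv R (tensorAct A U (a ⊗ₜ 1)) =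
        twistedCoeffAct hT t := (twistedCoeffAct_eq hT ht).symm
      rw [h2]
      -- Membership holds for every tensor in `A ⊗ C`, not only for coaction values; forgetting the
      -- origin of `t` allows induction on it.
      clear ht h1 h2
      induction t with
      | zero => simp
      | add s t hs ht => rw [map_add]; exact add_mem hs ht
      | tmul a c =>
        refine mul_mem (mulLeft_mem_range_smashAct _) ?_
        have := conj_tensorAct_one_tmul_mem (A := A) hT (⟨_, hC c c.2⟩ : (smashAct R H H U).range)
        rwa [tensorAct_tmul, LinearMap.mulLeft_one] at this

end Coefficients

end Duality

/-! ### The isomorphism and the two density hypotheses -/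

section Main

variable {R : Type u} [CommRing R] [IsNoetherianRing R] {H : Type v} [Ring H] [Bialgebra R H]
  {A : Type w} [Ring A] [Algebra R A] [Module H A] [IsModuleAlgebra R H A]

/-- Local finiteness says that `h ↦ h a` vanishes on a common kernel of finitely many elements of
`U`, so it comes from `A ⊗ U`; this produces `ϱ(a)`, which the coefficient hypothesis moves into `A
⊗ C`. -/
lemma exists_alphaMap_coefficients (hα : IsAlphaAlgebra R H) (U : Submodule R (H →ₗ[R] R))
    [IsSubbialgebra U] (hA : IsLocallyFinite U A) {C : Submodule R (H →ₗ[R] R)}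
    (hC : IsCoefficientSubmodule U A C) (a : A) :
    ∃ t : A ⊗[R] C, ∀ h : H, alphaMap C A t h = h • a := by
  obtain ⟨F, hF, ha⟩ := hA a
  obtain ⟨t, ht⟩ := exists_alphaMap_eq (fun M _ _ => alphaMap_injective hα U M)
    (LeftSmash.actOn R a) F hF ha
  have ht' : IsCoactionValue U a t := fun h => by rw [ht, LeftSmash.actOn_apply]
  obtain ⟨s, rfl⟩ := hC.mem_range a t ht'
  exact ⟨s, fun h => by rw [← alphaMap_inclusion hC.le]; exact ht' h⟩

variable (A) in
-- Two faithful actions on `A # H` with the same image; the density of `U` plays no role here.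
theorem nonempty_smash_algEquiv (hα : IsAlphaAlgebra R H) {T : H →ₗ[R] H}
    (hT : IsTwistedAntipode T) (U : Submodule R (H →ₗ[R] R)) [IsSubbialgebra U]
    (hA : IsLocallyFinite U A) {C : Submodule R (H →ₗ[R] R)} (hC : IsCoefficientSubmodule U A C)
    {V : Submodule R (H →ₗ[R] R)} (hCV : C ≤ V) (hTCV : ∀ f ∈ C, f ∘ₗ T ∈ V)
    (hRL : RLCondition V U) :
    Nonempty (RightSmash R H (LeftSmash R H A) U ≃ₐ[R] A ⊗[R] (smashAct R H H U).range) := by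
  have hU := alphaMap_injective hα U (A ⊗[R] H)
  let φ := ((twistEquiv A hT).conjAlgEquiv R).toAlgHom.comp (tensorAct A U)
  have hφ : Function.Injective φ :=
    ((twistEquiv A hT).conjAlgEquiv R).injective.comp (tensorAct_injective hT hU)
  have hrange := range_smashAct_eq hT (U := U) (exists_alphaMap_coefficients hα U hA hC)
    (fun c hc => rightHit_mem_range hRL (hCV hc)) (fun c hc => rightHit_mem_range hRL (hTCV c hc))
  exact ⟨(AlgEquiv.ofInjective _ (smashAct_leftSmash_injective hT hU)).trans
    ((Subalgebra.equivOfEq _ _ hrange).trans (AlgEquiv.ofInjective φ hφ).symm)⟩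

lemma isFinitelyDense_univ_of_isQuasiFrobenius (hR : IsQuasiFrobenius R)
    (hH : IsResiduallyFinite R H) {U : Submodule R (H →ₗ[R] R)}
    (hU : IsFinitelyDense (U : Set (H →ₗ[R] R)) (finiteDual R H : Set (H →ₗ[R] R))) :
    IsFinitelyDense (U : Set (H →ₗ[R] R)) Set.univ := by
  refine hU.trans (isFinitelyDense_univ_of_separating hR.selfInjective _ fun x hx => hH ?_)
  ext f
  simpa using hx f.1 f.2

end Main

end HopfDuality

end

open HopfDuality
theorem mainTheorem10 {R : Type*} [CommRing R] [IsNoetherianRing R]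
    {H : Type*} [Ring H] [HopfAlgebra R H] [Module.Projective R H]
    (hα : IsAlphaAlgebra R H)
    (T : H →ₗ[R] H) (hT : IsTwistedAntipode T)
    (U : Submodule R (H →ₗ[R] R)) [IsSubbialgebra U]
    {A : Type*} [Ring A] [Algebra R A] [Module H A] [IsModuleAlgebra R H A]
    (hA : IsLocallyFinite U A)
    (C : Submodule R (H →ₗ[R] R)) (hC : IsCoefficientSubmodule U A C)
    (V : Submodule R (H →ₗ[R] R)) (hV : IsRightHSubmodule V)
    (hCV : C ≤ V) (hTCV : ∀ f ∈ C, f ∘ₗ T ∈ V)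
    (hRL : RLCondition V U) :
    (IsFinitelyDense (U : Set (H →ₗ[R] R)) Set.univ →
      ∃ L : Subalgebra R (Module.End R H),
        IsFinitelyDense (L : Set (H →ₗ[R] H)) Set.univ ∧
        Nonempty (RightSmash R H (LeftSmash R H A) U ≃ₐ[R] A ⊗[R] L)) ∧
    (IsQuasiFrobenius R → IsResiduallyFinite R H →
      IsFinitelyDense (U : Set (H →ₗ[R] R)) (finiteDual R H : Set (H →ₗ[R] R)) →
      ∃ L : Subalgebra R (Module.End R H),
        IsFinitelyDense (L : Set (H →ₗ[R] H)) Set.univ ∧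
        Nonempty (RightSmash R H (LeftSmash R H A) U ≃ₐ[R] A ⊗[R] L)) := by 
  have hiso := nonempty_smash_algEquiv A hα hT U hA hC hCV hTCV hRL
  exact ⟨fun hU => ⟨_, isFinitelyDense_range_smashAct hT U hU, hiso⟩,
    fun hR hH hU => ⟨_, isFinitelyDense_range_smashAct hT U
      (isFinitelyDense_univ_of_isQuasiFrobenius hR hH hU), hiso⟩⟩
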